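/- Let $N\in\{2,3\}$, let $\Omega\subset\mathbb R^N$ be open, bounded and convex, let $d_n,c_n,d_p,c_p>0$, $D\in L^\infty(\Omega)$, $a_u\in H^2(\Omega)$ and $a_n,a_p\in H^1(\Omega)$. Put $$\mathcal H=(H^2(\Omega)\cap H^1_0(\Omega))\times H^1_0(\Omega)\times H^1_0(\Omega),\qquad \mathcal G=L^2(\Omega)\times H^{-1}(\Omega)\times H^{-1}(\Omega),$$ with the standard norm of $H^2(\Omega)$ on the first factor of $\mathcal H$, the norm $\|f\|_{H^1_0}=\|\nabla f\|_{L^2}$ on $H^1_0(\Omega)$, the corresponding dual norm on $H^{-1}(\Omega)=(H^1_0(\Omega))^*$, and Euclidean product norms. For $h=(\rho,\sigma,\tau)\in\mathcal H$ and $\lambda\in[0,1]$ put $(u,n,p)=(\rho+a_u,\sigma+a_n,\tau+a_p)$, and let $F=(F_1,F_2,F_3):\mathcal H\times[0,1]\to\mathcal G$ be the drift-diffusion map $$F_1(h,\lambda)=-\nabla^2u+\lambda(n-p)-D,$$ $$F_2(h,\lambda)[\phi]=\int_\Omega(d_n\nabla n-c_n\,n\nabla u)\cdot\nabla\phi\,dx,\qquad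 F_3(h,\lambda)[\psi]=\int_\Omega(d_p\nabla p+c_p\,p\nabla u)\cdot\nabla\psi\,dx\qquad(\phi,\psi\in H^1_0(\Omega)).$$ Then $F$ is well defined (the integrals converge absolutely and define elements of $H^{-1}(\Omega)$), the partial Fréchet derivative $F_h(h,\lambda)\in B[\mathcal H,\mathcal G]$ exists for all $(h,\lambda)\in\mathcal H\times[0,1]$, and $F_h$ is globally Lipschitz continuous in $(h,\lambda)$: there is a constant $C$ such that for all $h_1,h_2\in\mathcal H$ and $\lambda_1,\lambda_2\in[0,1]$, $$\|F_h(h_1,\lambda_1)-F_h(h_2,\lambda_2)\|_{B[\mathcal H,\mathcal G]}\le C\,\bigl\{\|h_1-h_2\|_{\mathcal H}^2+|\lambda_1-\lambda_2|^2\bigr\}^{1/2}.$$ -/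

import Mathlib

open MeasureTheory TopologicalSpace Set
open scoped ENNReal Distributions

noncomputable section

namespace DriftDiffusion

/-! ### Square integrable functions and weak derivatives -/

/-- The space `L²(Ω)`. -/
abbrev L2 {N : ℕ} (Ω : Opens (EuclideanSpace ℝ (Fin N))) : Type :=
  Lp ℝ 2 (volume.restrict (Ω : Set (EuclideanSpace ℝ (Fin N))))

variable {N : ℕ} {Ω : Opens (EuclideanSpace ℝ (Fin N))}

/-- The classical partial derivative `∂ᵢ φ`. -/
def partialDeriv (i : Fin N) (φ : EuclideanSpace ℝ (Fin N) → ℝ)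
    (x : EuclideanSpace ℝ (Fin N)) : ℝ :=
  fderiv ℝ φ x (EuclideanSpace.single i 1)

/-- `g` is the weak `i`-th partial derivative of `f` on `Ω`:
`∫_Ω f ∂ᵢφ = - ∫_Ω g φ` for every test function `φ ∈ C_c^∞(Ω)`. -/
def HasWeakPartial (i : Fin N) (f g : L2 Ω) : Prop :=
  ∀ φ : 𝓓(Ω, ℝ), ∫ x in (Ω : Set _), f x * partialDeriv i φ x = -∫ x in (Ω : Set _), g x * φ x

lemma memLp_test (φ : 𝓓(Ω, ℝ)) : MemLp φ 2 (volume.restrict (Ω : Set _)) :=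
  φ.continuous.memLp_of_hasCompactSupport φ.hasCompactSupport

lemma continuous_partialDeriv (φ : 𝓓(Ω, ℝ)) (i : Fin N) : Continuous (partialDeriv i φ) :=
  (φ.contDiff.continuous_fderiv (by simp)).clm_apply continuous_const

lemma hasCompactSupport_partialDeriv (φ : 𝓓(Ω, ℝ)) (i : Fin N) :
    HasCompactSupport (partialDeriv i φ) :=
  φ.hasCompactSupport.fderiv_apply (𝕜 := ℝ) _

lemma memLp_partialDeriv (φ : 𝓓(Ω, ℝ)) (i : Fin N) :
    MemLp (partialDeriv i φ) 2 (volume.restrict (Ω : Set _)) :=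
  (continuous_partialDeriv φ i).memLp_of_hasCompactSupport (hasCompactSupport_partialDeriv φ i)

lemma HasWeakPartial.zero (i : Fin N) : HasWeakPartial i (0 : L2 Ω) 0 := by
  intro φ
  have h : ∀ ψ : EuclideanSpace ℝ (Fin N) → ℝ,
      ∫ x in (Ω : Set _), (0 : L2 Ω) x * ψ x = 0 := by
    intro ψ
    apply integral_eq_zero_of_ae
    filter_upwards [Lp.coeFn_zero ℝ 2
      (volume.restrict (Ω : Set (EuclideanSpace ℝ (Fin N))))] with x hx
    rw [hx]; simp
  rw [h, h, neg_zero]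

lemma HasWeakPartial.add {i : Fin N} {f g f' g' : L2 Ω} (h : HasWeakPartial i f g)
    (h' : HasWeakPartial i f' g') : HasWeakPartial i (f + f') (g + g') := by
  intro φ
  have e1 : ∫ x in (Ω : Set _), (f + f') x * partialDeriv i φ x
      = ∫ x in (Ω : Set _), (f x * partialDeriv i φ x + f' x * partialDeriv i φ x) := by
    apply integral_congr_ae
    filter_upwards [Lp.coeFn_add f f'] with x hx
    rw [hx, Pi.add_apply, add_mul]
  have e2 : ∫ x in (Ω : Set _), (g + g') x * φ x
      = ∫ x in (Ω : Set _), (g x * φ x + g' x * φ x) := by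
    apply integral_congr_ae
    filter_upwards [Lp.coeFn_add g g'] with x hx
    rw [hx, Pi.add_apply, add_mul]
  have e3 := integral_add ((Lp.memLp f).integrable_mul (memLp_partialDeriv φ i))
    ((Lp.memLp f').integrable_mul (memLp_partialDeriv φ i))
  have e4 := integral_add ((Lp.memLp g).integrable_mul (memLp_test φ))
    ((Lp.memLp g').integrable_mul (memLp_test φ))
  simp only [Pi.mul_apply] at e3 e4
  rw [e1, e2, e3, e4, h φ, h' φ]
  ring

lemma HasWeakPartial.smul {i : Fin N} {f g : L2 Ω} (c : ℝ) (h : HasWeakPartial i f g) :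
    HasWeakPartial i (c • f) (c • g) := by
  intro φ
  have e1 : ∫ x in (Ω : Set _), (c • f) x * partialDeriv i φ x
      = ∫ x in (Ω : Set _), c * (f x * partialDeriv i φ x) := by
    apply integral_congr_ae
    filter_upwards [Lp.coeFn_smul c f] with x hx
    rw [hx, Pi.smul_apply, smul_eq_mul, mul_assoc]
  have e2 : ∫ x in (Ω : Set _), (c • g) x * φ x = ∫ x in (Ω : Set _), c * (g x * φ x) := by
    apply integral_congr_ae
    filter_upwards [Lp.coeFn_smul c g] with x hx
    rw [hx, Pi.smul_apply, smul_eq_mul, mul_assoc]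
  rw [e1, e2, integral_const_mul, integral_const_mul, h φ]
  ring

/-! ### The spaces `H¹(Ω)` and `H²(Ω)` -/

/-- Pairs `(f, ∇f)` of an `L²` function and its weak gradient. -/
def H1sub (Ω : Opens (EuclideanSpace ℝ (Fin N))) :
    Submodule ℝ (WithLp 2 (L2 Ω × PiLp 2 (fun _ : Fin N => L2 Ω))) where
  carrier := {v | ∀ i, HasWeakPartial i v.fst (v.snd i)}
  zero_mem' := fun i => HasWeakPartial.zero i
  add_mem' := fun ha hb i => (ha i).add (hb i)
  smul_mem' := fun c _ ha i => (ha i).smul c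

/-- `H¹(Ω)`: an element is an `L²` function `f` with its weak gradient `∇f ∈ L²` (which `f`
determines), and its norm is `(‖f‖² + ∑ᵢ ‖∂ᵢf‖²)^{1/2}`. -/
def H1 (Ω : Opens (EuclideanSpace ℝ (Fin N))) : Type := H1sub Ω

instance : NormedAddCommGroup (H1 Ω) := inferInstanceAs (NormedAddCommGroup (H1sub Ω))

instance : NormedSpace ℝ (H1 Ω) := inferInstanceAs (NormedSpace ℝ (H1sub Ω))

/-- The underlying `L²` function of an element of `H¹(Ω)`. -/
def H1.fn (v : H1 Ω) : L2 Ω :=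
  (Subtype.val (p := fun w => w ∈ H1sub Ω) v).fst

/-- The weak partial derivatives of an element of `H¹(Ω)`. -/
def H1.grad (v : H1 Ω) : PiLp 2 (fun _ : Fin N => L2 Ω) :=
  (Subtype.val (p := fun w => w ∈ H1sub Ω) v).snd

/-- Pairs `(f, D²f)` of an element of `H¹(Ω)` and its weak Hessian. -/
def H2sub (Ω : Opens (EuclideanSpace ℝ (Fin N))) :
    Submodule ℝ (WithLp 2 (H1 Ω × PiLp 2 (fun _ : Fin N × Fin N => L2 Ω))) where
  carrier := {v | ∀ i j, HasWeakPartial j (v.fst.grad i) (v.snd (i, j))}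
  zero_mem' := fun _ j => HasWeakPartial.zero j
  add_mem' := fun ha hb i j => (ha i j).add (hb i j)
  smul_mem' := fun c _ ha i j => (ha i j).smul c

/-- `H²(Ω)`: an element is some `f ∈ H¹(Ω)` with its weak Hessian `D²f ∈ L²` (which `f`
determines), and its norm is `(‖f‖² + ∑ᵢ ‖∂ᵢf‖² + ∑ᵢⱼ ‖∂ⱼ∂ᵢf‖²)^{1/2}`. -/
def H2 (Ω : Opens (EuclideanSpace ℝ (Fin N))) : Type := H2sub Ω

instance : NormedAddCommGroup (H2 Ω) := inferInstanceAs (NormedAddCommGroup (H2sub Ω))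

instance : NormedSpace ℝ (H2 Ω) := inferInstanceAs (NormedSpace ℝ (H2sub Ω))

/-- An element of `H²(Ω)` regarded in `H¹(Ω)`. -/
def H2.toH1 (v : H2 Ω) : H1 Ω :=
  (Subtype.val (p := fun w => w ∈ H2sub Ω) v).fst

/-- The weak second partial derivatives of an element of `H²(Ω)`. -/
def H2.hess (v : H2 Ω) : PiLp 2 (fun _ : Fin N × Fin N => L2 Ω) :=
  (Subtype.val (p := fun w => w ∈ H2sub Ω) v).snd

/-- The Laplacian `∑ᵢ ∂ᵢ∂ᵢ v ∈ L²(Ω)` of `v ∈ H²(Ω)`. -/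
def H2.laplacian (v : H2 Ω) : L2 Ω := ∑ i : Fin N, v.hess (i, i)

/-! ### The space `H¹₀(Ω)`, its dual, and `H²(Ω) ∩ H¹₀(Ω)` -/

/-- The test functions `C_c^∞(Ω)` as a subspace of `H¹(Ω)`. -/
def testSubmodule (Ω : Opens (EuclideanSpace ℝ (Fin N))) : Submodule ℝ (H1 Ω) where
  carrier := {v | ∃ φ : 𝓓(Ω, ℝ), v.fn =ᵐ[volume.restrict (Ω : Set _)] φ ∧
    ∀ i, v.grad i =ᵐ[volume.restrict (Ω : Set _)] partialDeriv i φ}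
  zero_mem' := by
    refine ⟨0, ?_, fun i => ?_⟩
    · exact Lp.coeFn_zero ℝ 2 _
    · refine (Lp.coeFn_zero ℝ 2 _).trans (Filter.Eventually.of_forall fun x => ?_)
      simp [partialDeriv]
  add_mem' := by
    rintro a b ⟨φ, h1, h2⟩ ⟨ψ, h3, h4⟩
    refine ⟨φ + ψ, ?_, fun i => ?_⟩
    · exact (Lp.coeFn_add a.fn b.fn).trans (h1.add h3)
    · refine (Lp.coeFn_add (a.grad i) (b.grad i)).trans (((h2 i).add (h4 i)).trans
        (Filter.Eventually.of_forall fun x => ?_))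
      have e := fderiv_add (𝕜 := ℝ) ((φ.contDiff.differentiable (by simp)) x)
        ((ψ.contDiff.differentiable (by simp)) x)
      simp [partialDeriv, e]
  smul_mem' := by
    rintro c a ⟨φ, h1, h2⟩
    refine ⟨c • φ, ?_, fun i => ?_⟩
    · exact (Lp.coeFn_smul c a.fn).trans (h1.const_smul c)
    · refine (Lp.coeFn_smul c (a.grad i)).trans (((h2 i).const_smul c).trans
        (Filter.Eventually.of_forall fun x => ?_))
      have e := fderiv_const_smul (𝕜 := ℝ) ((φ.contDiff.differentiable (by simp)) x) c
      simp [partialDeriv, e]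

/-- `H¹₀(Ω)` as a subspace of `H¹(Ω)`: the closure of `C_c^∞(Ω)`. -/
def H10sub (Ω : Opens (EuclideanSpace ℝ (Fin N))) : Submodule ℝ (H1 Ω) :=
  (testSubmodule Ω).topologicalClosure

/-- `H²(Ω) ∩ H¹₀(Ω)` as a subspace of `H²(Ω)`. -/
def H2H10sub (Ω : Opens (EuclideanSpace ℝ (Fin N))) : Submodule ℝ (H2 Ω) where
  carrier := {v | v.toH1 ∈ H10sub Ω}
  zero_mem' := (H10sub Ω).zero_mem
  add_mem' := fun ha hb => (H10sub Ω).add_mem ha hb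
  smul_mem' := fun c _ ha => (H10sub Ω).smul_mem c ha

/-- `H²(Ω) ∩ H¹₀(Ω)`, with the norm of `H²(Ω)`. -/
def H2H10 (Ω : Opens (EuclideanSpace ℝ (Fin N))) : Type := H2H10sub Ω

instance : NormedAddCommGroup (H2H10 Ω) := inferInstanceAs (NormedAddCommGroup (H2H10sub Ω))

instance : NormedSpace ℝ (H2H10 Ω) := inferInstanceAs (NormedSpace ℝ (H2H10sub Ω))

/-- An element of `H²(Ω) ∩ H¹₀(Ω)` regarded in `H²(Ω)`. -/
def H2H10.toH2 (v : H2H10 Ω) : H2 Ω := Subtype.val (p := fun w => w ∈ H2H10sub Ω) v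

/-- `H¹₀(Ω)` as a space of its own; it carries the norm `‖∇f‖_{L²}` (see below). -/
def H10 (Ω : Opens (EuclideanSpace ℝ (Fin N))) : Type := H10sub Ω

instance : AddCommGroup (H10 Ω) := inferInstanceAs (AddCommGroup (H10sub Ω))

instance : Module ℝ (H10 Ω) := inferInstanceAs (Module ℝ (H10sub Ω))

/-- An element of `H¹₀(Ω)` regarded in `H¹(Ω)`. -/
def H10.toH1 (v : H10 Ω) : H1 Ω := Subtype.val (p := fun w => w ∈ H10sub Ω) v

/-- The gradient `f ↦ ∇f` on `H¹₀(Ω)`. -/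
def H10.gradₗ (Ω : Opens (EuclideanSpace ℝ (Fin N))) :
    H10 Ω →ₗ[ℝ] PiLp 2 (fun _ : Fin N => L2 Ω) where
  toFun v := v.toH1.grad
  map_add' _ _ := rfl
  map_smul' _ _ := rfl

lemma norm_sq_L2 (f : L2 Ω) : ‖f‖ ^ 2 = ∫ x in (Ω : Set _), f x ^ 2 := by
  rw [← real_inner_self_eq_norm_sq, L2.inner_def]
  simp [sq]

/-- Poincaré's inequality for test functions. -/
lemma poincare_test [NeZero N] {R : ℝ} (hR : ∀ x ∈ Ω, ‖x‖ ≤ R) (φ : 𝓓(Ω, ℝ)) :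
    ∫ x in (Ω : Set _), φ x ^ 2 ≤ 4 * R ^ 2 * ∫ x in (Ω : Set _), partialDeriv 0 φ x ^ 2 := by
  have hφ0 : ∀ x ∉ Ω, φ x = 0 := fun x hx =>
    image_eq_zero_of_notMem_tsupport fun h => hx (φ.tsupport_subset h)
  have hd : Differentiable ℝ φ := φ.contDiff.differentiable (by simp)
  have hc := φ.continuous
  have hpc := continuous_partialDeriv φ (0 : Fin N)
  have hcs := φ.hasCompactSupport
  let L : EuclideanSpace ℝ (Fin N) →L[ℝ] ℝ := EuclideanSpace.proj 0
  have hL : ∀ x, fderiv ℝ L x (EuclideanSpace.single 0 1) = 1 := by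
    intro x; rw [L.fderiv]; simp [L]
  have hfd : ∀ x, fderiv ℝ (fun y => φ y ^ 2) x (EuclideanSpace.single 0 1)
      = 2 * (φ x * partialDeriv 0 φ x) := by
    intro x
    rw [fderiv_fun_pow 2 (hd x)]
    simp [partialDeriv]; ring
  have cs2 : HasCompactSupport (fun y => φ y ^ 2) := by
    have := hcs.mul_right (f' := φ)
    simpa [sq] using! this
  have csm : HasCompactSupport (fun y => φ y * partialDeriv 0 φ y) :=
    hcs.mul_right
  have csd : HasCompactSupport (fun y => partialDeriv 0 φ y ^ 2) := by
    have := (hasCompactSupport_partialDeriv φ (0 : Fin N)).mul_right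
      (f' := partialDeriv 0 φ)
    simpa [sq] using! this
  have ibp : ∫ x, φ x ^ 2 * fderiv ℝ L x (EuclideanSpace.single 0 1)
      = - ∫ x, fderiv ℝ (fun y => φ y ^ 2) x (EuclideanSpace.single 0 1) * L x := by
    apply integral_mul_fderiv_eq_neg_fderiv_mul_of_integrable
    · simp_rw [hfd]
      exact Continuous.integrable_of_hasCompactSupport (by fun_prop)
        ((csm.mul_left (f := fun _ => (2 : ℝ))).mul_right)
    · simp_rw [hL, mul_one]
      exact Continuous.integrable_of_hasCompactSupport (by fun_prop) cs2
    · exact Continuous.integrable_of_hasCompactSupport (by fun_prop) cs2.mul_right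
    · intro x _; exact (hd x).pow 2
    · intro x _; exact L.differentiableAt
  simp_rw [hL, mul_one, hfd] at ibp
  rw [← setIntegral_eq_integral_of_forall_compl_eq_zero (s := (Ω : Set _))
      (f := fun x => φ x ^ 2) (fun x hx => by simp [hφ0 x hx]),
    ← setIntegral_eq_integral_of_forall_compl_eq_zero (s := (Ω : Set _))
      (f := fun x => 2 * (φ x * partialDeriv 0 φ x) * L x)
      (fun x hx => by simp [hφ0 x hx]), ← integral_neg] at ibp
  have i2 : IntegrableOn (fun y => φ y ^ 2) (Ω : Set _) :=
    (Continuous.integrable_of_hasCompactSupport (by fun_prop) cs2).integrableOn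
  have id2 : IntegrableOn (fun y => partialDeriv 0 φ y ^ 2) (Ω : Set _) :=
    (Continuous.integrable_of_hasCompactSupport (by fun_prop) csd).integrableOn
  have im : IntegrableOn (fun y => -(2 * (φ y * partialDeriv 0 φ y) * L y)) (Ω : Set _) :=
    (Continuous.integrable_of_hasCompactSupport (by fun_prop)
      ((csm.mul_left (f := fun _ => (2 : ℝ))).mul_right)).neg.integrableOn
  have key : ∫ x in (Ω : Set _), -(2 * (φ x * partialDeriv 0 φ x) * L x)
      ≤ ∫ x in (Ω : Set _), (1 / 2 * φ x ^ 2 + 2 * R ^ 2 * partialDeriv 0 φ x ^ 2) := by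
    refine setIntegral_mono_on im ((i2.const_mul _).add (id2.const_mul _))
      Ω.isOpen.measurableSet fun x hx => ?_
    have h1 : |L x| ≤ R := by
      have := EuclideanSpace.norm_eq x
      have h2 : ‖x 0‖ ≤ ‖x‖ := PiLp.norm_apply_le x 0
      exact h2.trans (hR x hx)
    have h3 : (L x) ^ 2 ≤ R ^ 2 := sq_le_sq' (by linarith [abs_le.1 h1]) (abs_le.1 h1).2
    have h4 := mul_le_mul_of_nonneg_right h3 (sq_nonneg (partialDeriv 0 φ x))
    nlinarith [sq_nonneg (φ x + 2 * (L x * partialDeriv 0 φ x))]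
  rw [integral_add (i2.const_mul _) (id2.const_mul _), integral_const_mul,
    integral_const_mul, ← ibp] at key
  linarith

lemma poincare [NeZero N] {R : ℝ} (hR : ∀ x ∈ Ω, ‖x‖ ≤ R) {v : H1 Ω} (hv : v ∈ H10sub Ω) :
    ‖v.fn‖ ^ 2 ≤ 4 * R ^ 2 * ‖v.grad 0‖ ^ 2 := by
  have hcl : IsClosed {w : H1 Ω | ‖w.fn‖ ^ 2 ≤ 4 * R ^ 2 * ‖w.grad 0‖ ^ 2} := by
    refine isClosed_le ?_ ?_
    · unfold H1.fn; fun_prop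
    · unfold H1.grad; fun_prop
  refine closure_minimal ?_ hcl hv
  rintro w ⟨φ, h1, h2⟩
  change ‖w.fn‖ ^ 2 ≤ 4 * R ^ 2 * ‖w.grad 0‖ ^ 2
  have e1 : ∫ x in (Ω : Set _), w.fn x ^ 2 = ∫ x in (Ω : Set _), φ x ^ 2 :=
    integral_congr_ae (h1.mono fun x hx => by simp only [hx])
  have e2 : ∫ x in (Ω : Set _), w.grad 0 x ^ 2 = ∫ x in (Ω : Set _), partialDeriv 0 φ x ^ 2 :=
    integral_congr_ae ((h2 0).mono fun x hx => by simp only [hx])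
  rw [norm_sq_L2, norm_sq_L2, e1, e2]
  exact poincare_test hR φ

variable [NeZero N] [hΩ : Fact (Bornology.IsBounded (Ω : Set (EuclideanSpace ℝ (Fin N))))]

lemma H10.gradₗ_injective : Function.Injective (H10.gradₗ Ω) := by
  rw [← LinearMap.ker_eq_bot, LinearMap.ker_eq_bot']
  intro v hv
  obtain ⟨R, hR⟩ := hΩ.out.exists_norm_le
  have hg : v.toH1.grad = 0 := hv
  have h := poincare hR v.2
  have h0 : ‖v.toH1.fn‖ ^ 2 ≤ 0 := by
    have e : v.toH1.grad 0 = 0 := by rw [hg]; rfl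
    refine h.trans_eq ?_
    change 4 * R ^ 2 * ‖v.toH1.grad 0‖ ^ 2 = 0
    rw [e]; simp
  have hf : v.toH1.fn = 0 := by
    rw [← norm_eq_zero]
    exact pow_eq_zero_iff (two_ne_zero) |>.1 (le_antisymm h0 (sq_nonneg _))
  apply Subtype.ext
  apply Subtype.ext
  exact (WithLp.ofLp_injective 2) (Prod.ext hf hg)

/-- The norm `‖f‖_{H¹₀} = ‖∇f‖_{L²}`. -/
instance : NormedAddCommGroup (H10 Ω) :=
  NormedAddCommGroup.induced (H10 Ω) _ (H10.gradₗ Ω) H10.gradₗ_injective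

instance : NormedSpace ℝ (H10 Ω) := NormedSpace.induced ℝ (H10 Ω) _ (H10.gradₗ Ω)

lemma H10.norm_def (v : H10 Ω) : ‖v‖ = ‖v.toH1.grad‖ := rfl

instance : IsFiniteMeasure (volume.restrict (Ω : Set (EuclideanSpace ℝ (Fin N)))) :=
  ⟨by simpa using! hΩ.out.measure_lt_top⟩

/-- `H⁻¹(Ω)`, the dual of `H¹₀(Ω)`, with the dual norm. -/
abbrev Hneg1 (Ω : Opens (EuclideanSpace ℝ (Fin N)))
    [Fact (Bornology.IsBounded (Ω : Set (EuclideanSpace ℝ (Fin N))))] : Type :=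
  StrongDual ℝ (H10 Ω)

/-- `𝓗 = (H²(Ω) ∩ H¹₀(Ω)) × H¹₀(Ω) × H¹₀(Ω)`, with the Euclidean product norm. -/
abbrev Hspace (Ω : Opens (EuclideanSpace ℝ (Fin N)))
    [Fact (Bornology.IsBounded (Ω : Set (EuclideanSpace ℝ (Fin N))))] : Type :=
  WithLp 2 (H2H10 Ω × WithLp 2 (H10 Ω × H10 Ω))

/-- `𝓖 = L²(Ω) × H⁻¹(Ω) × H⁻¹(Ω)`, with the Euclidean product norm. -/
abbrev Gspace (Ω : Opens (EuclideanSpace ℝ (Fin N)))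
    [Fact (Bornology.IsBounded (Ω : Set (EuclideanSpace ℝ (Fin N))))] : Type :=
  WithLp 2 (L2 Ω × WithLp 2 (Hneg1 Ω × Hneg1 Ω))

/-! ### The drift-diffusion map -/

/-- `ℓ ∈ H⁻¹(Ω)` is `-∇ · w`: all the integrals `∫_Ω w · ∇φ`, `φ ∈ H¹₀(Ω)`, converge absolutely
and `ℓ[φ] = ∫_Ω w · ∇φ`. -/
def IsNegDiv (w : Fin N → EuclideanSpace ℝ (Fin N) → ℝ) (ℓ : Hneg1 Ω) : Prop :=
  ∀ φ : H10 Ω,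
    IntegrableOn (fun x => ∑ i, w i x * φ.toH1.grad i x) (Ω : Set _) ∧
    ℓ φ = ∫ x in (Ω : Set _), ∑ i, w i x * φ.toH1.grad i x

open Classical in
/-- `-∇ · w` as an element of `H⁻¹(Ω)` (and `0` if `-∇ · w` is not an element of `H⁻¹(Ω)`). -/
def negDiv (Ω : Opens (EuclideanSpace ℝ (Fin N)))
    [Fact (Bornology.IsBounded (Ω : Set (EuclideanSpace ℝ (Fin N))))]
    (w : Fin N → EuclideanSpace ℝ (Fin N) → ℝ) : Hneg1 Ω :=
  if h : ∃ ℓ : Hneg1 Ω, IsNegDiv w ℓ then h.choose else 0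

/-- The flux `d ∇m - c m ∇u` of negative carriers of density `m` in the potential `u`. -/
def fluxNeg (d c : ℝ) (m : H1 Ω) (u : H2 Ω) (i : Fin N) (x : EuclideanSpace ℝ (Fin N)) : ℝ :=
  d * m.grad i x - c * m.fn x * u.toH1.grad i x

/-- The flux `d ∇m + c m ∇u` of positive carriers of density `m` in the potential `u`. -/
def fluxPos (d c : ℝ) (m : H1 Ω) (u : H2 Ω) (i : Fin N) (x : EuclideanSpace ℝ (Fin N)) : ℝ :=
  d * m.grad i x + c * m.fn x * u.toH1.grad i x

/-- `D ∈ L^∞(Ω)` regarded in `L²(Ω)`. -/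
def inftyToL2 (D : Lp ℝ ∞ (volume.restrict (Ω : Set (EuclideanSpace ℝ (Fin N))))) : L2 Ω :=
  ((Lp.memLp D).mono_exponent le_top).toLp D

/-- The potential `u = ρ + a_u` at `h = (ρ, σ, τ)`. -/
def potential (au : H2 Ω) (h : Hspace Ω) : H2 Ω := h.fst.toH2 + au

/-- The density `n = σ + a_n` of negative carriers at `h = (ρ, σ, τ)`. -/
def negDensity (an : H1 Ω) (h : Hspace Ω) : H1 Ω := h.snd.fst.toH1 + an

/-- The density `p = τ + a_p` of positive carriers at `h = (ρ, σ, τ)`. -/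
def posDensity (ap : H1 Ω) (h : Hspace Ω) : H1 Ω := h.snd.snd.toH1 + ap

/-- The drift-diffusion map `F(h; λ)`, with components
`F₁ = -∇²u + λ (n - p) - D`, `F₂ = -∇ · (dₙ ∇n - cₙ n ∇u)`, `F₃ = -∇ · (dₚ ∇p + cₚ p ∇u)`. -/
def driftDiffusionMap (dn cn dp cp : ℝ)
    (D : Lp ℝ ∞ (volume.restrict (Ω : Set (EuclideanSpace ℝ (Fin N)))))
    (au : H2 Ω) (an ap : H1 Ω) (h : Hspace Ω) (lam : ℝ) : Gspace Ω :=
  WithLp.toLp 2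
    (-(potential au h).laplacian + lam • ((negDensity an h).fn - (posDensity ap h).fn)
        - inftyToL2 D,
      WithLp.toLp 2
        (negDiv Ω (fluxNeg dn cn (negDensity an h) (potential au h)),
          negDiv Ω (fluxPos dp cp (posDensity ap h) (potential au h))))

end DriftDiffusion

end

open DriftDiffusion

/-! In `h`, the map is a constant plus a bounded linear term plus a bounded quadratic term, and `λ`
enters affinely, multiplying only constant and linear terms. So `F_h(h, λ) = A + λ L + Q(h, ·) +
Q(·, h)` is affine in `(h, λ)`, and it is globally Lipschitz with constant `‖Q + Qᵗ‖ + ‖L‖`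
(`exists_lipschitz_fderiv_quadratic`).

The analytic content is that `Q` is bounded: `(m, u) ↦ -∇ · (m ∇u)` must be a bounded bilinear map
from `H¹ × H²` to `H⁻¹` (`exists_driftL`). By Hölder it is enough that `m` and each `∂ᵢu`, both
functions in `H¹`, lie in `L⁴` with a norm bound, since then `m ∂ᵢu` is in `L²`. The same fact gives
the absolute convergence of the integrals.

The embedding `H¹ ⊂ L⁴` (`exists_eLpNorm_four_le`) is proved directly on a bounded convex `Ω`. Fix a
bump `η` in `Ω` of integral one and average `f((1 - t) x + t y)` over `y` with weight `η(y)`. At `t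
= 1` this is a fixed mean of `f`; as `t → 0` it tends to `f(x)` at Lebesgue points. Its
`t`-derivative tests the weak gradient against a field supported in `Ω` by convexity, of size at
most a multiple of `t⁻ᴺ` on the ball of radius `d t` about `x`. Hence `|f(x) - mean|` is at most a
multiple of a Riesz-type potential of `|∇f|` (`ae_enorm_sub_le_ballPotential`). Two weighted
Cauchy–Schwarz inequalities and Tonelli bound that potential in `L⁴` by the `L²` norm of `|∇f|` when
`N ≤ 3` (`lintegral_ballPotential_pow_four_le`). -/

noncomputable section

namespace DriftDiffusion

open Filter Topology

section Kernel

variable {N : ℕ} {Ω : Opens (EuclideanSpace ℝ (Fin N))}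

/-! ### Averaging kernels contracting to a point of a convex domain -/

/-- The kernel `t⁻ᴺ η(x + (z - x) / t)`. Integrated against it, `f` becomes the average of
`f((1 - t) x + t y)` with weight `η(y)`. -/
def contractKernel (η : EuclideanSpace ℝ (Fin N) → ℝ) (x : EuclideanSpace ℝ (Fin N)) (t : ℝ)
    (z : EuclideanSpace ℝ (Fin N)) : ℝ :=
  (t ^ N)⁻¹ * η (x + t⁻¹ • (z - x))

variable {η : EuclideanSpace ℝ (Fin N) → ℝ} {x : EuclideanSpace ℝ (Fin N)} {t : ℝ}

lemma tsupport_contractKernel_subset :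
    tsupport (contractKernel η x t) ⊆ (fun z => x + t⁻¹ • (z - x)) ⁻¹' tsupport η := by
  refine closure_minimal (fun z hz => subset_tsupport η ?_)
    ((isClosed_tsupport η).preimage (by fun_prop))
  rw [Function.mem_support] at hz ⊢
  exact right_ne_zero_of_mul hz

lemma hasCompactSupport_contractKernel (hη : HasCompactSupport η) (ht : 0 < t) :
    HasCompactSupport (contractKernel η x t) := by
  refine ((hη.isCompact.image (f := fun y => x + t • (y - x)) (by fun_prop)).of_isClosed_subset
    (isClosed_tsupport _) fun z hz => ⟨_, tsupport_contractKernel_subset hz, ?_⟩)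
  simp [smul_smul, ht.ne']

/-- A point of the support is `(1 - t) x + t y` with `y` in the support of `η`. This is where
convexity of the domain is used; it makes the kernels admissible in the definition of weak
derivatives. -/
lemma tsupport_contractKernel_subset_of_convex (hΩ : Convex ℝ (Ω : Set (EuclideanSpace ℝ (Fin N))))
    (hη : tsupport η ⊆ Ω) (hx : x ∈ Ω) (ht : 0 < t) (ht1 : t ≤ 1) :
    tsupport (contractKernel η x t) ⊆ Ω := by
  intro z hz
  have h := hΩ hx (hη (tsupport_contractKernel_subset hz)) (sub_nonneg.2 ht1) ht.le (by ring)
  convert h using 1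
  simp only [smul_add, smul_smul, mul_inv_cancel₀ ht.ne']
  module

lemma contDiff_contractKernel {n : WithTop ℕ∞} (hη : ContDiff ℝ n η) :
    ContDiff ℝ n (contractKernel η x t) := by
  unfold contractKernel
  fun_prop

lemma exists_test_mul_contractKernel (hΩ : Convex ℝ (Ω : Set (EuclideanSpace ℝ (Fin N)))) (hη : ContDiff ℝ (⊤ : ℕ∞) η)
    (hc : HasCompactSupport η) (hs : tsupport η ⊆ Ω) (hx : x ∈ Ω) (ht : 0 < t) (ht1 : t ≤ 1)
    {a : EuclideanSpace ℝ (Fin N) → ℝ} (ha : ContDiff ℝ (⊤ : ℕ∞) a) :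
    ∃ ψ : 𝓓(Ω, ℝ), ⇑ψ = fun z => a z * contractKernel η x t z :=
  ⟨⟨fun z => a z * contractKernel η x t z, ha.mul (contDiff_contractKernel hη),
    (hasCompactSupport_contractKernel hc ht).mul_left,
    (tsupport_mul_subset_right).trans
      (tsupport_contractKernel_subset_of_convex hΩ hs hx ht ht1)⟩, rfl⟩

/-- The divergence in `z` of the field `t⁻¹ (z - x) K(z)`, where `K` is `contractKernel η x t`; it is
also `-∂K/∂t`. -/
def contractKernelDiv (η : EuclideanSpace ℝ (Fin N) → ℝ) (x : EuclideanSpace ℝ (Fin N)) (t : ℝ)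
    (z : EuclideanSpace ℝ (Fin N)) : ℝ :=
  (t ^ N)⁻¹ * t⁻¹ * (N * η (x + t⁻¹ • (z - x))
    + fderiv ℝ η (x + t⁻¹ • (z - x)) (t⁻¹ • (z - x)))

lemma sum_partialDeriv_contractKernel (hη : ContDiff ℝ (⊤ : ℕ∞) η)
    (z : EuclideanSpace ℝ (Fin N)) :
    ∑ i, partialDeriv i (fun z => t⁻¹ * (z i - x i) * contractKernel η x t z) z
      = contractKernelDiv η x t z := by
  have hd : DifferentiableAt ℝ η (x + t⁻¹ • (z - x)) := (hη.differentiable (by simp)) _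
  have hK : HasFDerivAt (contractKernel η x t)
      ((t ^ N)⁻¹ • (fderiv ℝ η (x + t⁻¹ • (z - x))).comp
        (t⁻¹ • ContinuousLinearMap.id ℝ (EuclideanSpace ℝ (Fin N)))) z := by
    have h1 : HasFDerivAt (fun z : EuclideanSpace ℝ (Fin N) => x + t⁻¹ • (z - x))
        (t⁻¹ • ContinuousLinearMap.id ℝ (EuclideanSpace ℝ (Fin N))) z :=
      (((hasFDerivAt_id z).sub_const x).const_smul t⁻¹).const_add x
    exact (hd.hasFDerivAt.comp z h1).const_mul _
  have hp : ∀ i, partialDeriv i (fun z => t⁻¹ * (z i - x i) * contractKernel η x t z) z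
      = t⁻¹ * contractKernel η x t z + (t ^ N)⁻¹ * t⁻¹ * (t⁻¹ * ((z i - x i) *
        fderiv ℝ η (x + t⁻¹ • (z - x)) (EuclideanSpace.single i 1))) := by
    intro i
    have hl : HasFDerivAt (fun z : EuclideanSpace ℝ (Fin N) => t⁻¹ * (z i - x i))
        (t⁻¹ • (EuclideanSpace.proj i : EuclideanSpace ℝ (Fin N) →L[ℝ] ℝ)) z :=
      (((EuclideanSpace.proj i : EuclideanSpace ℝ (Fin N) →L[ℝ] ℝ).hasFDerivAt).sub_const
        (x i)).const_mul t⁻¹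
    unfold partialDeriv
    rw [(hl.fun_mul hK).fderiv]
    simp
    ring
  have hz : fderiv ℝ η (x + t⁻¹ • (z - x)) (z - x) = ∑ i, (z i - x i) *
      fderiv ℝ η (x + t⁻¹ • (z - x)) (EuclideanSpace.single i 1) := by
    -- The base point also contains `z - x`; hiding it lets the basis expansion act on the argument
    -- alone.
    generalize fderiv ℝ η (x + t⁻¹ • (z - x)) = L
    conv_lhs => rw [← (EuclideanSpace.basisFun (Fin N) ℝ).sum_repr (z - x)]
    simp
  simp_rw [hp]
  rw [Finset.sum_add_distrib, ← Finset.mul_sum, ← Finset.mul_sum, ← Finset.mul_sum, ← hz]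
  rw [contractKernelDiv, map_smul, smul_eq_mul]
  simp only [Finset.sum_const, Finset.card_univ, Fintype.card_fin, nsmul_eq_mul, contractKernel]
  ring

/-- The kernel is the density of `η` transported by `y ↦ x + t (y - x)`, whose velocity at `z` is
`t⁻¹ (z - x)`. Together with `sum_partialDeriv_contractKernel` this is the continuity equation for
that flow. -/
lemma hasDerivAt_contractKernel (hη : ContDiff ℝ (⊤ : ℕ∞) η) (ht : 0 < t)
    (z : EuclideanSpace ℝ (Fin N)) :
    HasDerivAt (fun s => contractKernel η x s z) (-contractKernelDiv η x t z) t := by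
  have hd : DifferentiableAt ℝ η (x + t⁻¹ • (z - x)) := (hη.differentiable (by simp)) _
  have h1 : HasDerivAt (fun s : ℝ => x + s⁻¹ • (z - x)) (-(t ^ 2)⁻¹ • (z - x)) t :=
    ((hasDerivAt_inv ht.ne').smul_const (z - x)).const_add x
  have h2 := hd.hasFDerivAt.comp_hasDerivAt t h1
  have h3 : HasDerivAt (fun s : ℝ => (s ^ N)⁻¹) (-(N * (t ^ N)⁻¹ * t⁻¹)) t := by
    have := (hasDerivAt_pow N t).fun_inv (pow_ne_zero N ht.ne')
    convert! this using 1
    -- The derivative of `s ^ N` contains the truncated exponent `N - 1`, so `N = 0` is separate.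
    rcases N with _ | n
    · simp
    · have := ht.ne'
      field_simp
      simp
      ring
  convert! h3.mul h2 using 1
  simp only [contractKernelDiv, map_smul, smul_eq_mul, Function.comp]
  have := ht.ne'
  field_simp
  ring

lemma integral_contractKernel (ht : 0 < t) :
    ∫ z, contractKernel η x t z = ∫ z, η z := by
  simp only [contractKernel]
  rw [integral_const_mul, integral_sub_right_eq_self (fun z => η (x + t⁻¹ • z)) x,
    Measure.integral_comp_inv_smul_of_nonneg volume (fun z => η (x + z)) ht.le,
    integral_add_left_eq_self]
  simp [ht.ne']

/-- `η` is bounded and `contractKernel` is concentrated on the ball of radius `d t`. -/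
lemma abs_contractKernel_le {d M : ℝ}
    (hd : ∀ y ∈ Ω, ∀ x ∈ Ω, ‖y - x‖ ≤ d) (hM : ∀ y, |η y| ≤ M) (hs : tsupport η ⊆ Ω)
    (hx : x ∈ Ω) (ht : 0 < t) (z : EuclideanSpace ℝ (Fin N)) :
    |contractKernel η x t z| ≤
      (Metric.closedBall x (d * t)).indicator (fun _ => M * (t ^ N)⁻¹) z := by
  have hp : 0 < (t ^ N)⁻¹ := inv_pos.2 (pow_pos ht N)
  by_cases hz : η (x + t⁻¹ • (z - x)) = 0
  · rw [contractKernel, hz, mul_zero, abs_zero]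
    exact indicator_nonneg (fun _ _ => mul_nonneg ((abs_nonneg _).trans (hM x)) hp.le) _
  · have h1 := hd _ (hs (subset_tsupport η hz)) x hx
    rw [add_sub_cancel_left, norm_smul, norm_inv, Real.norm_of_nonneg ht.le,
      inv_mul_le_iff₀ ht] at h1
    rw [indicator_of_mem (by rw [Metric.mem_closedBall, dist_eq_norm]; linarith), contractKernel,
      abs_mul, abs_of_pos hp, mul_comm]
    exact mul_le_mul_of_nonneg_right (hM _) hp.le

end Kernel

section Potential

variable {N : ℕ} {Ω : Opens (EuclideanSpace ℝ (Fin N))}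

/-! ### An `L⁴` bound for averages over contracting balls -/

lemma lintegral_mul_sq_le {α : Type*} [MeasurableSpace α] (μ : Measure α) {f g : α → ℝ≥0∞}
    (hf : AEMeasurable f μ) (hg : AEMeasurable g μ) :
    (∫⁻ a, f a * g a ∂μ) ^ 2 ≤ (∫⁻ a, f a ^ 2 ∂μ) * ∫⁻ a, g a ^ 2 ∂μ := by
  have h := ENNReal.lintegral_mul_le_Lp_mul_Lq μ Real.HolderConjugate.two_two hf hg
  simp only [Pi.mul_apply, ENNReal.rpow_two] at h
  calc _ ≤ _ := pow_le_pow_left' h 2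
    _ = _ := by
      rw [mul_pow, ← ENNReal.rpow_natCast, ← ENNReal.rpow_natCast, ← ENNReal.rpow_mul,
        ← ENNReal.rpow_mul]
      norm_num

lemma lintegral_rpow_Ioc_lt_top {r : ℝ} (hr : -1 < r) :
    ∫⁻ t in Ioc (0 : ℝ) 1, ENNReal.ofReal t ^ r < ∞ := by
  have h := (intervalIntegral.intervalIntegrable_rpow' (a := 0) (b := 1) hr).1.2
  rw [hasFiniteIntegral_iff_enorm] at h
  refine lt_of_le_of_lt (setLIntegral_mono' measurableSet_Ioc fun t ht => ?_) h
  rw [ENNReal.ofReal_rpow_of_pos ht.1]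
  exact Real.ofReal_le_enorm _

/-- The indicator function of `|z - x| ≤ d t`. -/
def nearIndicator (d : ℝ) (x : EuclideanSpace ℝ (Fin N)) (t : ℝ)
    (z : EuclideanSpace ℝ (Fin N)) : ℝ≥0∞ :=
  (Metric.closedBall x (d * t)).indicator (fun _ => 1) z

@[fun_prop]
lemma measurable_nearIndicator {α : Type*} [MeasurableSpace α] (d : ℝ)
    {f g : α → EuclideanSpace ℝ (Fin N)} {s : α → ℝ} (hf : Measurable f) (hs : Measurable s)
    (hg : Measurable g) : Measurable fun a => nearIndicator d (f a) (s a) (g a) := by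
  have e : (fun a => nearIndicator d (f a) (s a) (g a))
      = {a | dist (g a) (f a) ≤ d * s a}.indicator (fun _ => 1) := by
    ext a
    simp only [nearIndicator, indicator, Metric.mem_closedBall, mem_ofPred_eq]
  rw [e]
  exact measurable_const.indicator (measurableSet_le (by fun_prop) (by fun_prop))

lemma nearIndicator_sq (d : ℝ) (x : EuclideanSpace ℝ (Fin N)) (t : ℝ)
    (z : EuclideanSpace ℝ (Fin N)) : nearIndicator d x t z ^ 2 = nearIndicator d x t z := by
  unfold nearIndicator
  by_cases h : z ∈ Metric.closedBall x (d * t)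
  · simp [indicator_of_mem h]
  · simp [indicator_of_notMem h]

lemma lintegral_nearIndicator_le {d : ℝ} (hd : 0 ≤ d) {t : ℝ} (ht : 0 ≤ t)
    (x : EuclideanSpace ℝ (Fin N)) :
    ∫⁻ z in (Ω : Set _), nearIndicator d x t z
      ≤ ENNReal.ofReal t ^ (N : ℝ) *
        volume (Metric.closedBall (0 : EuclideanSpace ℝ (Fin N)) d) := by
  refine (setLIntegral_le_lintegral _ _).trans ?_
  unfold nearIndicator
  rw [lintegral_indicator_const Metric.isClosed_closedBall.measurableSet, one_mul, mul_comm d,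
    Measure.addHaar_closedBall_mul _ _ ht hd, finrank_euclideanSpace_fin,
    ENNReal.ofReal_pow ht, ENNReal.rpow_natCast]

lemma nearIndicator_comm (d : ℝ) (x : EuclideanSpace ℝ (Fin N)) (t : ℝ)
    (z : EuclideanSpace ℝ (Fin N)) : nearIndicator d x t z = nearIndicator d z t x := by
  simp only [nearIndicator, indicator, Metric.mem_closedBall, dist_comm]

/-- The integral of `t⁻ᴺ ∫_{Ω ∩ B(x, d t)} G` over `0 < t ≤ 1`. -/
def ballPotential (Ω : Opens (EuclideanSpace ℝ (Fin N))) (d : ℝ)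
    (G : EuclideanSpace ℝ (Fin N) → ℝ≥0∞) (x : EuclideanSpace ℝ (Fin N)) : ℝ≥0∞ :=
  ∫⁻ t in Ioc (0 : ℝ) 1, ∫⁻ z in (Ω : Set _),
    G z * (ENNReal.ofReal t ^ (-N : ℝ) * nearIndicator d x t z)

lemma ofReal_rpow_mul_rpow {t : ℝ} (ht : 0 < t) (r s : ℝ) :
    ENNReal.ofReal t ^ r * ENNReal.ofReal t ^ s = ENNReal.ofReal t ^ (r + s) := by
  rw [ENNReal.rpow_add _ _ (by simpa using ht) ENNReal.ofReal_ne_top]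

lemma ofReal_rpow_sq {t : ℝ} (ht : 0 < t) (r : ℝ) :
    (ENNReal.ofReal t ^ r) ^ 2 = ENNReal.ofReal t ^ (2 * r) := by
  rw [sq, ofReal_rpow_mul_rpow ht, two_mul]

/-- The integral of `tʳ ∫_{Ω ∩ B(x, d t)} G²` over `0 < t ≤ 1`. -/
def ballEnergy (Ω : Opens (EuclideanSpace ℝ (Fin N))) (d r : ℝ)
    (G : EuclideanSpace ℝ (Fin N) → ℝ≥0∞) (x : EuclideanSpace ℝ (Fin N)) : ℝ≥0∞ :=
  ∫⁻ t in Ioc (0 : ℝ) 1, ∫⁻ z in (Ω : Set _),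
    G z ^ 2 * (ENNReal.ofReal t ^ r * nearIndicator d x t z)

/-- `∫ t^{-3/4}` over `0 < t ≤ 1`. -/
def weightIntegral : ℝ≥0∞ := ∫⁻ t in Ioc (0 : ℝ) 1, ENNReal.ofReal t ^ (-(3 / 4) : ℝ)

lemma weightIntegral_ne_top : weightIntegral ≠ ∞ :=
  (lintegral_rpow_Ioc_lt_top (by norm_num)).ne

/-- Cauchy–Schwarz in `(t, z)` with `t⁻ᴺ` split as `t^(-3/8 - N/2) · t^(3/8 - N/2)`. The first
factor squared, integrated over a ball of volume comparable to `tᴺ`, leaves the integrable weight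
`t^(-3/4)`. -/
lemma ballPotential_sq_le {d : ℝ} (hd : 0 ≤ d) {G : EuclideanSpace ℝ (Fin N) → ℝ≥0∞}
    (hG : Measurable G) (x : EuclideanSpace ℝ (Fin N)) :
    ballPotential Ω d G x ^ 2 ≤
      (weightIntegral * volume (Metric.closedBall (0 : EuclideanSpace ℝ (Fin N)) d)) *
        ballEnergy Ω d (3 / 4 - N) G x := by
  have hctop : volume (Metric.closedBall (0 : EuclideanSpace ℝ (Fin N)) d) ≠ ∞ :=
    measure_closedBall_lt_top.ne
  have hμpos : ∀ᵐ t ∂(volume.restrict (Ioc (0 : ℝ) 1)), t ∈ Ioc (0 : ℝ) 1 :=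
    ae_restrict_mem measurableSet_Ioc
  have e : ballPotential Ω d G x = ∫⁻ p : ℝ × EuclideanSpace ℝ (Fin N),
      (ENNReal.ofReal p.1 ^ (-(3 / 8) - N / 2 : ℝ) * nearIndicator d x p.1 p.2) *
      (G p.2 * (ENNReal.ofReal p.1 ^ (3 / 8 - N / 2 : ℝ) * nearIndicator d x p.1 p.2))
      ∂((volume.restrict (Ioc (0 : ℝ) 1)).prod (volume.restrict (Ω : Set _))) := by
    rw [lintegral_prod _ (by fun_prop)]
    refine lintegral_congr_ae (hμpos.mono fun t ht => lintegral_congr fun z => ?_)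
    have e1 := ofReal_rpow_mul_rpow ht.1 (3 / 8 - N / 2) (-(3 / 8) - N / 2)
    rw [show (3 / 8 - N / 2 : ℝ) + (-(3 / 8) - N / 2) = -N by ring] at e1
    rw [← e1]
    -- An indicator equals its square, so each Cauchy–Schwarz factor can carry a copy.
    conv_lhs => rw [← nearIndicator_sq d x t z]
    ring
  rw [e]
  refine (lintegral_mul_sq_le _ (by fun_prop) (by fun_prop)).trans ?_
  rw [lintegral_prod _ (by fun_prop), lintegral_prod _ (by fun_prop)]
  refine mul_le_mul' ?_ ?_
  · rw [weightIntegral, ← lintegral_mul_const' _ _ hctop]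
    refine lintegral_mono_ae (hμpos.mono fun t ht => ?_)
    simp only [mul_pow, nearIndicator_sq]
    rw [lintegral_const_mul _ (by fun_prop)]
    refine (mul_le_mul_right (lintegral_nearIndicator_le hd ht.1.le x) _).trans ?_
    rw [ofReal_rpow_sq ht.1, ← mul_assoc, ofReal_rpow_mul_rpow ht.1]
    refine le_of_eq ?_
    congr 2; ring
  · refine lintegral_mono_ae (hμpos.mono fun t ht => le_of_eq (lintegral_congr fun z => ?_))
    simp only [mul_pow, nearIndicator_sq, ofReal_rpow_sq ht.1]
    congr 3; ring

/-- A second Cauchy–Schwarz, with the indicator kept in one factor only. The other factor is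
`t^(-3/8) G`, whose square integrates to `weightIntegral` times the full integral of `G²`,
independently of `x`. -/
lemma ballEnergy_sq_le (d : ℝ) {G : EuclideanSpace ℝ (Fin N) → ℝ≥0∞}
    (hG : Measurable G) (x : EuclideanSpace ℝ (Fin N)) :
    ballEnergy Ω d (3 / 4 - N) G x ^ 2 ≤
      (weightIntegral * ∫⁻ z in (Ω : Set _), G z ^ 2) * ballEnergy Ω d (9 / 4 - 2 * N) G x := by
  have hμpos : ∀ᵐ t ∂(volume.restrict (Ioc (0 : ℝ) 1)), t ∈ Ioc (0 : ℝ) 1 :=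
    ae_restrict_mem measurableSet_Ioc
  have e : ballEnergy Ω d (3 / 4 - N) G x = ∫⁻ p : ℝ × EuclideanSpace ℝ (Fin N),
      (ENNReal.ofReal p.1 ^ (-(3 / 8) : ℝ) * G p.2) *
      (G p.2 * (ENNReal.ofReal p.1 ^ (9 / 8 - N : ℝ) * nearIndicator d x p.1 p.2))
      ∂((volume.restrict (Ioc (0 : ℝ) 1)).prod (volume.restrict (Ω : Set _))) := by
    rw [lintegral_prod _ (by fun_prop)]
    refine lintegral_congr_ae (hμpos.mono fun t ht => lintegral_congr fun z => ?_)
    have e1 := ofReal_rpow_mul_rpow ht.1 (-(3 / 8)) (9 / 8 - N)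
    rw [show (-(3 / 8) : ℝ) + (9 / 8 - N) = 3 / 4 - N by ring] at e1
    rw [← e1]
    ring
  rw [e]
  refine (lintegral_mul_sq_le _ (by fun_prop) (by fun_prop)).trans ?_
  rw [lintegral_prod _ (by fun_prop), lintegral_prod _ (by fun_prop)]
  refine mul_le_mul' ?_ ?_
  · rw [weightIntegral, ← lintegral_mul_const _ (by fun_prop)]
    refine lintegral_mono_ae (hμpos.mono fun t ht => le_of_eq ?_)
    simp only [mul_pow, ofReal_rpow_sq ht.1]
    rw [lintegral_const_mul _ (by fun_prop)]
    congr 2; ring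
  · refine lintegral_mono_ae (hμpos.mono fun t ht => le_of_eq (lintegral_congr fun z => ?_))
    simp only [mul_pow, nearIndicator_sq, ofReal_rpow_sq ht.1]
    congr 3; ring

lemma measurable_ballEnergy (d r : ℝ) {G : EuclideanSpace ℝ (Fin N) → ℝ≥0∞}
    (hG : Measurable G) : Measurable (ballEnergy Ω d r G) := by
  have hm : Measurable fun q : (EuclideanSpace ℝ (Fin N) × ℝ) × EuclideanSpace ℝ (Fin N) =>
      G q.2 ^ 2 * (ENNReal.ofReal q.1.2 ^ r * nearIndicator d q.1.1 q.1.2 q.2) := by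
    fun_prop
  exact (hm.lintegral_prod_right' (ν := volume.restrict (Ω : Set _))).lintegral_prod_right'
    (ν := volume.restrict (Ioc (0 : ℝ) 1))

/-- By Tonelli and the symmetry of the indicator, integrating in `x` first contributes a factor
`tᴺ`, which leaves `t^(9/4 - N)`. This is at most `t^(-3/4)` on `(0, 1]` exactly because `N ≤ 3`.
The weight `-3/4` is the choice for which all three weights coincide in dimension three. -/
lemma lintegral_ballEnergy_le (hN : N ≤ 3) {d : ℝ} (hd : 0 ≤ d)
    {G : EuclideanSpace ℝ (Fin N) → ℝ≥0∞} (hG : Measurable G) :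
    ∫⁻ x in (Ω : Set _), ballEnergy Ω d (9 / 4 - 2 * N) G x ≤
      (weightIntegral * volume (Metric.closedBall (0 : EuclideanSpace ℝ (Fin N)) d)) *
        ∫⁻ z in (Ω : Set _), G z ^ 2 := by
  have hN' : (N : ℝ) ≤ 3 := by exact_mod_cast hN
  have hμpos : ∀ᵐ t ∂(volume.restrict (Ioc (0 : ℝ) 1)), t ∈ Ioc (0 : ℝ) 1 :=
    ae_restrict_mem measurableSet_Ioc
  have hm : Measurable fun q : (EuclideanSpace ℝ (Fin N) × ℝ) × EuclideanSpace ℝ (Fin N) =>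
      G q.2 ^ 2 * (ENNReal.ofReal q.1.2 ^ (9 / 4 - 2 * N : ℝ) *
        nearIndicator d q.1.1 q.1.2 q.2) := by fun_prop
  simp only [ballEnergy]
  rw [lintegral_lintegral_swap
    (hm.lintegral_prod_right' (ν := volume.restrict (Ω : Set _))).aemeasurable,
    weightIntegral, mul_assoc, ← lintegral_mul_const _ (by fun_prop)]
  refine lintegral_mono_ae (hμpos.mono fun t ht => ?_)
  rw [lintegral_lintegral_swap (by fun_prop), ← lintegral_const_mul _ (by fun_prop),
    ← lintegral_const_mul _ (by fun_prop)]
  refine lintegral_mono fun z => ?_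
  have hz : ∫⁻ x in (Ω : Set (EuclideanSpace ℝ (Fin N))), nearIndicator d x t z ≤ _ :=
    (lintegral_congr fun x => nearIndicator_comm d x t z).trans_le
      (lintegral_nearIndicator_le (Ω := Ω) hd ht.1.le z)
  rw [lintegral_const_mul _ (by fun_prop), lintegral_const_mul _ (by fun_prop)]
  calc _ ≤ G z ^ 2 * (ENNReal.ofReal t ^ (9 / 4 - 2 * N : ℝ) * (ENNReal.ofReal t ^ (N : ℝ) *
        volume (Metric.closedBall (0 : EuclideanSpace ℝ (Fin N)) d))) := by gcongr
    _ = ENNReal.ofReal t ^ (9 / 4 - 2 * N + N : ℝ) *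
        (volume (Metric.closedBall (0 : EuclideanSpace ℝ (Fin N)) d) * G z ^ 2) := by
      rw [← ofReal_rpow_mul_rpow ht.1]; ring
    _ ≤ _ := by
      gcongr ?_ * _
      exact ENNReal.rpow_le_rpow_of_exponent_ge (by simpa using ht.2) (by linarith)

lemma lintegral_ballPotential_pow_four_le (hN : N ≤ 3) {d : ℝ} (hd : 0 ≤ d) :
    ∃ C : ℝ≥0∞, C ≠ ∞ ∧ ∀ G : EuclideanSpace ℝ (Fin N) → ℝ≥0∞, Measurable G →
      ∫⁻ x in (Ω : Set _), ballPotential Ω d G x ^ 4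
        ≤ C * (∫⁻ z in (Ω : Set _), G z ^ 2) ^ 2 := by
  have hctop : volume (Metric.closedBall (0 : EuclideanSpace ℝ (Fin N)) d) ≠ ∞ :=
    measure_closedBall_lt_top.ne
  have hA := weightIntegral_ne_top
  refine ⟨(weightIntegral * volume (Metric.closedBall (0 : EuclideanSpace ℝ (Fin N)) d)) ^ 2 *
    weightIntegral * (weightIntegral * volume (Metric.closedBall (0 : EuclideanSpace ℝ (Fin N)) d)), by finiteness,
    fun G hG => ?_⟩
  refine (lintegral_mono fun x => ?_ : _ ≤ ∫⁻ x in (Ω : Set (EuclideanSpace ℝ (Fin N))),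
    (weightIntegral * volume (Metric.closedBall (0 : EuclideanSpace ℝ (Fin N)) d)) ^ 2 *
      (weightIntegral * ∫⁻ z in (Ω : Set _), G z ^ 2) *
      ballEnergy Ω d (9 / 4 - 2 * N) G x).trans ?_
  · calc ballPotential Ω d G x ^ 4 = (ballPotential Ω d G x ^ 2) ^ 2 := by ring
      _ ≤ _ := pow_le_pow_left' (ballPotential_sq_le hd hG x) 2
      _ ≤ _ := by
        rw [mul_pow, mul_assoc]
        exact mul_le_mul_right (ballEnergy_sq_le d hG x) _
  · rw [lintegral_const_mul _ (measurable_ballEnergy d _ hG)]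
    refine (mul_le_mul_right (lintegral_ballEnergy_le hN hd hG) _).trans (le_of_eq ?_)
    ring

end Potential

section Pointwise

variable {N : ℕ} {Ω : Opens (EuclideanSpace ℝ (Fin N))}
variable {η : EuclideanSpace ℝ (Fin N) → ℝ} {x : EuclideanSpace ℝ (Fin N)} {t : ℝ}

/-! ### A pointwise bound for functions with weak derivatives -/

lemma exists_normalized_bump (h : (Ω : Set (EuclideanSpace ℝ (Fin N))).Nonempty) :
    ∃ η : EuclideanSpace ℝ (Fin N) → ℝ, ContDiff ℝ (⊤ : ℕ∞) η ∧ HasCompactSupport η ∧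
      tsupport η ⊆ Ω ∧ ∫ y, η y = 1 := by
  obtain ⟨a, ha⟩ := h
  obtain ⟨r, hr, hs⟩ := Metric.nhds_basis_closedBall.mem_iff.1 (Ω.isOpen.mem_nhds ha)
  let b : ContDiffBump a := ⟨r / 2, r, by positivity, by linarith⟩
  refine ⟨b.normed volume, b.contDiff_normed, b.hasCompactSupport_normed, ?_, b.integral_normed⟩
  rw [b.tsupport_normed_eq]
  exact hs

lemma abs_contractKernelDiv_le {d M M' s : ℝ} (hM : ∀ y, |η y| ≤ M)
    (hM' : ∀ y, ‖fderiv ℝ η y‖ ≤ M') (hs : 0 < s) (hst : s ≤ t)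
    {z : EuclideanSpace ℝ (Fin N)} (hz : ‖z - x‖ ≤ d) :
    |contractKernelDiv η x t z| ≤ (s ^ N)⁻¹ * s⁻¹ * (N * M + M' * (s⁻¹ * d)) := by
  have ht : 0 < t := hs.trans_le hst
  have h1 : t⁻¹ ≤ s⁻¹ := inv_anti₀ hs hst
  have h2 : (t ^ N)⁻¹ ≤ (s ^ N)⁻¹ := inv_anti₀ (by positivity) (by gcongr)
  have hM0 : 0 ≤ M := (abs_nonneg _).trans (hM x)
  have hM'0 : 0 ≤ M' := (norm_nonneg _).trans (hM' x)
  have hd0 : 0 ≤ d := (norm_nonneg _).trans hz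
  have h3 : |fderiv ℝ η (x + t⁻¹ • (z - x)) (t⁻¹ • (z - x))| ≤ M' * (s⁻¹ * d) := by
    refine ((fderiv ℝ η (x + t⁻¹ • (z - x))).le_opNorm _).trans ?_
    rw [norm_smul, Real.norm_of_nonneg (by positivity : 0 ≤ t⁻¹)]
    gcongr
    exact hM' _
  rw [contractKernelDiv, abs_mul, abs_of_pos (by positivity : 0 < (t ^ N)⁻¹ * t⁻¹)]
  gcongr
  refine (abs_add_le _ _).trans (add_le_add ?_ h3)
  rw [abs_mul, Nat.abs_cast]
  gcongr
  exact hM _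

lemma continuous_contractKernelDiv (hη : ContDiff ℝ (⊤ : ℕ∞) η) :
    Continuous (contractKernelDiv η x t) := by
  have h1 := hη.continuous
  have h2 := hη.continuous_fderiv (by simp)
  unfold contractKernelDiv
  fun_prop

/-- The weak derivative of the averages of `f` along the contraction to `x`. -/
lemma hasDerivAt_integral_contractKernel (hΩ : Convex ℝ (Ω : Set (EuclideanSpace ℝ (Fin N))))
    (hb : Bornology.IsBounded (Ω : Set (EuclideanSpace ℝ (Fin N))))
    (hη : ContDiff ℝ (⊤ : ℕ∞) η) (hc : HasCompactSupport η) (hs : tsupport η ⊆ Ω) (hx : x ∈ Ω)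
    (ht : 0 < t) (ht1 : t ≤ 1) {f : L2 Ω} {g : Fin N → L2 Ω} (hf : ∀ i, HasWeakPartial i f (g i)) :
    HasDerivAt (fun s => ∫ z in (Ω : Set _), f z * contractKernel η x s z)
      (∫ z in (Ω : Set _), ∑ i, g i z * (t⁻¹ * (z i - x i) * contractKernel η x t z)) t := by
  have : IsFiniteMeasure (volume.restrict (Ω : Set (EuclideanSpace ℝ (Fin N)))) :=
    ⟨by simpa using! hb.measure_lt_top⟩
  obtain ⟨M, hM⟩ := hη.continuous.bounded_above_of_compact_support hc
  obtain ⟨M', hM'⟩ := (hη.continuous_fderiv (by simp)).bounded_above_of_compact_support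
    (hc.fderiv (𝕜 := ℝ))
  obtain ⟨d, hd⟩ := hb.exists_norm_le
  have hxd : ∀ z ∈ (Ω : Set _), ‖z - x‖ ≤ d + d := fun z hz =>
    (norm_sub_le _ _).trans (add_le_add (hd z hz) (hd x hx))
  have hfi : Integrable f (volume.restrict (Ω : Set _)) := (Lp.memLp f).integrable (by norm_num)
  -- The kernel is singular at `s = 0`; on `s > t / 2` its `s`-derivative has a bound uniform over
  -- `z` in `Ω`, so a multiple of `|f|` dominates.
  have key := hasDerivAt_integral_of_dominated_loc_of_deriv_le
    (μ := volume.restrict (Ω : Set (EuclideanSpace ℝ (Fin N))))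
    (F := fun s z => f z * contractKernel η x s z)
    (F' := fun s z => f z * -contractKernelDiv η x s z) (x₀ := t) (s := Ioi (t / 2))
    (bound := fun z => |f z| * (((t / 2) ^ N)⁻¹ * (t / 2)⁻¹ *
      (N * M + M' * ((t / 2)⁻¹ * (d + d)))))
    (Ioi_mem_nhds (by linarith))
    (Eventually.of_forall fun s => (Lp.aestronglyMeasurable f).mul
      (contDiff_contractKernel hη).continuous.aestronglyMeasurable)
    ((Lp.memLp f).integrable_mul
      ((contDiff_contractKernel hη).continuous.memLp_of_hasCompactSupport (p := 2)
        (hasCompactSupport_contractKernel hc ht)))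
    ((Lp.aestronglyMeasurable f).mul (continuous_contractKernelDiv hη).neg.aestronglyMeasurable)
    ((ae_restrict_mem Ω.isOpen.measurableSet).mono fun z hz s hs => by
      rw [norm_mul, norm_neg, Real.norm_eq_abs, Real.norm_eq_abs]
      gcongr
      exact abs_contractKernelDiv_le hM hM' (by linarith) (le_of_lt hs) (hxd z hz))
    (hfi.abs.mul_const _)
    (Eventually.of_forall fun z s hs => (hasDerivAt_contractKernel hη
      (lt_trans (by linarith) hs) z).const_mul _)
  refine key.2.congr_deriv (Eq.symm ?_)
  -- The components of velocity times kernel are test functions on `Ω`, so the divergence can be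
  -- moved onto `f` as its weak gradient.
  have hψ : ∀ i, ∃ ψ : 𝓓(Ω, ℝ), ⇑ψ = fun z => t⁻¹ * (z i - x i) * contractKernel η x t z :=
    fun i => exists_test_mul_contractKernel hΩ hη hc hs hx ht ht1 (by fun_prop)
  choose ψ hψ using hψ
  have hψz : ∀ i z, t⁻¹ * (z i - x i) * contractKernel η x t z = ψ i z := fun i z => by rw [hψ]
  have hdiv : ∀ z, contractKernelDiv η x t z = ∑ i, partialDeriv i (ψ i) z := fun z => by
    simp only [hψ, sum_partialDeriv_contractKernel hη]
  simp only [hdiv, hψz, mul_neg, Finset.mul_sum]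
  have i1 : ∀ i ∈ Finset.univ, Integrable (fun z => g i z * ψ i z)
      (volume.restrict (Ω : Set (EuclideanSpace ℝ (Fin N)))) :=
    fun i _ => (Lp.memLp (g i)).integrable_mul (memLp_test (ψ i))
  have i2 : ∀ i ∈ Finset.univ, Integrable (fun z => f z * partialDeriv i (ψ i) z)
      (volume.restrict (Ω : Set (EuclideanSpace ℝ (Fin N)))) :=
    fun i _ => (Lp.memLp f).integrable_mul (memLp_partialDeriv (ψ i) i)
  rw [integral_finsetSum _ i1, integral_neg, integral_finsetSum _ i2, ← Finset.sum_neg_distrib]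
  exact Finset.sum_congr rfl fun i _ => by rw [hf i (ψ i), neg_neg]

/-- No integrability need be assumed: if the right side is infinite there is nothing to prove, and
otherwise the fundamental theorem of calculus applies, measurability coming from `deriv U`. -/
lemma enorm_sub_le_lintegral_deriv {U U' : ℝ → ℝ} {a b : ℝ} (hab : a ≤ b)
    (h : ∀ s ∈ Icc a b, HasDerivAt U (U' s) s) :
    ‖U b - U a‖ₑ ≤ ∫⁻ s in Ioc a b, ‖U' s‖ₑ := by
  by_cases hfin : ∫⁻ s in Ioc a b, ‖U' s‖ₑ = ∞
  · rw [hfin]; exact le_top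
  have hm : AEStronglyMeasurable U' (volume.restrict (Ioc a b)) :=
    (stronglyMeasurable_deriv U).aestronglyMeasurable.congr
      ((ae_restrict_mem measurableSet_Ioc).mono fun s hs => (h s (Ioc_subset_Icc_self hs)).deriv)
  have hi : IntervalIntegrable U' volume a b :=
    (intervalIntegrable_iff_integrableOn_Ioc_of_le hab).2
      ⟨hm, by rw [hasFiniteIntegral_iff_enorm]; exact lt_top_iff_ne_top.2 hfin⟩
  rw [← intervalIntegral.integral_eq_sub_of_hasDerivAt (by rwa [uIcc_of_le hab]) hi,
    intervalIntegral.integral_of_le hab]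
  exact enorm_integral_le_lintegral_enorm _

/-- The averages of `f` contract to `f` at its Lebesgue points. -/
lemma ae_tendsto_integral_contractKernel (hΩ : Convex ℝ (Ω : Set (EuclideanSpace ℝ (Fin N))))
    {d : ℝ} (hd0 : 0 < d) (hd : ∀ y ∈ Ω, ∀ x ∈ Ω, ‖y - x‖ ≤ d)
    (hη : ContDiff ℝ (⊤ : ℕ∞) η) (hc : HasCompactSupport η) (hs : tsupport η ⊆ Ω)
    (h1 : ∫ y, η y = 1) {f : EuclideanSpace ℝ (Fin N) → ℝ}
    (hf : IntegrableOn f (Ω : Set (EuclideanSpace ℝ (Fin N)))) :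
    ∀ᵐ x ∂volume.restrict (Ω : Set (EuclideanSpace ℝ (Fin N))),
      Tendsto (fun t => ∫ z in (Ω : Set _), f z * contractKernel η x t z) (𝓝[>] 0) (𝓝 (f x)) := by
  obtain ⟨M, hM⟩ := hη.continuous.bounded_above_of_compact_support hc
  have hM0 : 0 ≤ M := (norm_nonneg _).trans (hM 0)
  -- Extension by zero makes the Lebesgue differentiation theorem on the whole space available; it
  -- costs nothing because the kernels vanish outside `Ω`.
  set F := (Ω : Set (EuclideanSpace ℝ (Fin N))).indicator f with hF
  have hFi : Integrable F := (integrable_indicator_iff Ω.isOpen.measurableSet).2 hf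
  have hleb := IsUnifLocDoublingMeasure.ae_tendsto_average_norm_sub volume
    hFi.locallyIntegrable 1
  filter_upwards [ae_restrict_mem Ω.isOpen.measurableSet, ae_restrict_of_ae hleb] with x hx hLx
  have hδ : Tendsto (fun t : ℝ => d * t) (𝓝[>] 0) (𝓝[>] 0) := by
    refine tendsto_nhdsWithin_iff.2 ⟨?_, ?_⟩
    · have : Tendsto (fun t : ℝ => d * t) (𝓝 0) (𝓝 (d * 0)) := by
        exact (continuous_const.mul continuous_id).tendsto 0
      rw [mul_zero] at this
      exact this.mono_left nhdsWithin_le_nhds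
    · filter_upwards [self_mem_nhdsWithin] with t ht using mul_pos hd0 ht
  have hlim := hLx (fun _ : ℝ => x) (fun t => d * t) hδ (by
    filter_upwards [self_mem_nhdsWithin] with t ht
    exact Metric.mem_closedBall_self (by rw [one_mul]; exact (mul_pos hd0 ht).le))
  have hlim2 := hlim.const_mul (M * (d ^ N *
    volume.real (Metric.ball (0 : EuclideanSpace ℝ (Fin N)) 1)))
  rw [mul_zero] at hlim2
  rw [tendsto_iff_norm_sub_tendsto_zero]
  refine squeeze_zero' (Eventually.of_forall fun _ => norm_nonneg _) ?_ hlim2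
  filter_upwards [Ioc_mem_nhdsGT (zero_lt_one' ℝ)] with t ht
  have ht0 : 0 < t := ht.1
  have hK0 : ∀ z ∉ Ω, contractKernel η x t z = 0 := fun z hz =>
    image_eq_zero_of_notMem_tsupport fun h =>
      hz (tsupport_contractKernel_subset_of_convex hΩ hs hx ht.1 ht.2 h)
  have hKc : Continuous (contractKernel η x t) := (contDiff_contractKernel hη).continuous
  have hKcs : HasCompactSupport (contractKernel η x t) :=
    hasCompactSupport_contractKernel hc ht0
  have hKi : Integrable (contractKernel η x t) := hKc.integrable_of_hasCompactSupport hKcs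
  obtain ⟨B, hB⟩ := hKc.bounded_above_of_compact_support hKcs
  have hFK : Integrable fun z => F z * contractKernel η x t z :=
    hFi.mul_bdd hKc.aestronglyMeasurable (Eventually.of_forall hB)
  have e1 : ∫ z in (Ω : Set _), f z * contractKernel η x t z
      = ∫ z, F z * contractKernel η x t z := by
    rw [← setIntegral_eq_integral_of_forall_compl_eq_zero (s := (Ω : Set _))
      (f := fun z => F z * contractKernel η x t z) (fun z hz => by simp [hK0 z hz])]
    refine setIntegral_congr_fun Ω.isOpen.measurableSet fun z hz => ?_
    simp only [hF, indicator_of_mem hz]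
  -- The kernel has total mass one, so the error is an integral of `F z - F x` against it. The
  -- kernel is at most `M t⁻ᴺ` on a ball of volume proportional to `tᴺ`, so a fixed multiple of the
  -- mean oscillation bounds the error.
  have e2 : f x = ∫ z, F x * contractKernel η x t z := by
    rw [integral_const_mul, integral_contractKernel ht0, h1, mul_one, hF,
      indicator_of_mem (show x ∈ (Ω : Set _) from hx)]
  have hvol : volume.real (Metric.closedBall x (d * t))
      = t ^ N * (d ^ N * volume.real (Metric.ball (0 : EuclideanSpace ℝ (Fin N)) 1)) := by
    rw [Measure.addHaar_real_closedBall _ _ (by positivity), finrank_euclideanSpace_fin]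
    ring
  rw [e1, e2, ← integral_sub hFK (hKi.const_mul _)]
  calc ‖∫ z, (F z * contractKernel η x t z - F x * contractKernel η x t z)‖
      ≤ ∫ z, (Metric.closedBall x (d * t)).indicator
          (fun z => M * (t ^ N)⁻¹ * ‖F z - F x‖) z := by
        refine norm_integral_le_of_norm_le ?_ (Eventually.of_forall fun z => ?_)
        · rw [integrable_indicator_iff Metric.isClosed_closedBall.measurableSet]
          refine Integrable.const_mul (Integrable.norm ?_) _
          exact hFi.integrableOn.sub (integrableOn_const measure_closedBall_lt_top.ne)
        · have hk := abs_contractKernel_le hd hM hs hx ht0 z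
          rw [← sub_mul, norm_mul, Real.norm_eq_abs (contractKernel η x t z)]
          refine (mul_le_mul_of_nonneg_left hk (norm_nonneg _)).trans (le_of_eq ?_)
          by_cases hz : z ∈ Metric.closedBall x (d * t)
          · rw [indicator_of_mem hz, indicator_of_mem hz, mul_comm]
          · rw [indicator_of_notMem hz, indicator_of_notMem hz, mul_zero]
    _ = M * (d ^ N * volume.real (Metric.ball (0 : EuclideanSpace ℝ (Fin N)) 1)) *
        ⨍ z in Metric.closedBall x (d * t), ‖F z - F x‖ := by
        have hpos : (0 : ℝ) < d ^ N * volume.real (Metric.ball (0 : EuclideanSpace ℝ (Fin N)) 1) :=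
          mul_pos (by positivity) (ENNReal.toReal_pos
            (Metric.measure_ball_pos _ _ one_pos).ne' measure_ball_lt_top.ne)
        rw [integral_indicator Metric.isClosed_closedBall.measurableSet, integral_const_mul,
          setAverage_eq, hvol, smul_eq_mul]
        have h3 := ht0.ne'
        have h4 := hpos.ne'
        generalize d ^ N * volume.real (Metric.ball (0 : EuclideanSpace ℝ (Fin N)) 1) = V at h4 ⊢
        field_simp

/-- A function with weak derivatives `gᵢ` is bounded, up to an average, by a potential of `|g|`. -/
lemma ae_enorm_sub_le_ballPotential (hΩ : Convex ℝ (Ω : Set (EuclideanSpace ℝ (Fin N))))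
    {d M : ℝ} (hd0 : 0 < d) (hd : ∀ y ∈ Ω, ∀ x ∈ Ω, ‖y - x‖ ≤ d)
    (hb : Bornology.IsBounded (Ω : Set (EuclideanSpace ℝ (Fin N))))
    (hη : ContDiff ℝ (⊤ : ℕ∞) η) (hc : HasCompactSupport η) (hs : tsupport η ⊆ Ω)
    (h1 : ∫ y, η y = 1) (hM : ∀ y, |η y| ≤ M) {f : L2 Ω} {g : Fin N → L2 Ω}
    (hf : ∀ i, HasWeakPartial i f (g i)) :
    ∀ᵐ x ∂volume.restrict (Ω : Set (EuclideanSpace ℝ (Fin N))),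
      ‖(∫ z in (Ω : Set _), f z * η z) - f x‖ₑ ≤
        ENNReal.ofReal (d * M) * ballPotential Ω d (fun z => ∑ i, ‖g i z‖ₑ) x := by
  have : IsFiniteMeasure (volume.restrict (Ω : Set (EuclideanSpace ℝ (Fin N)))) :=
    ⟨by simpa using! hb.measure_lt_top⟩
  have hfi : Integrable f (volume.restrict (Ω : Set _)) := (Lp.memLp f).integrable (by norm_num)
  have hM0 : 0 ≤ M := (abs_nonneg _).trans (hM 0)
  have hK1 : ∀ x, contractKernel η x 1 = η := fun x => by ext z; simp [contractKernel]
  filter_upwards [ae_restrict_mem Ω.isOpen.measurableSet,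
    ae_tendsto_integral_contractKernel hΩ hd0 hd hη hc hs h1 hfi] with x hx hlim
  -- It suffices to bound the change of the average between `t = s` and `t = 1`, uniformly in small
  -- `s`; at `t = 1` the kernel is `η` itself.
  refine le_of_tendsto (hlim.const_sub _).enorm ?_
  filter_upwards [Ioc_mem_nhdsGT (zero_lt_one' ℝ)] with s hs'
  have hftc := enorm_sub_le_lintegral_deriv hs'.2 fun t ht =>
    hasDerivAt_integral_contractKernel hΩ hb hη hc hs hx (hs'.1.trans_le ht.1) ht.2 hf
  rw [hK1] at hftc
  refine hftc.trans ((lintegral_mono_set (Ioc_subset_Ioc_left hs'.1.le)).trans ?_)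
  rw [ballPotential, ← lintegral_const_mul' _ _ ENNReal.ofReal_ne_top]
  refine setLIntegral_mono' measurableSet_Ioc fun t ht => ?_
  refine (enorm_integral_le_lintegral_enorm _).trans ?_
  rw [← lintegral_const_mul' _ _ ENNReal.ofReal_ne_top]
  refine lintegral_mono fun z => ?_
  refine (enorm_sum_le _ _).trans ?_
  rw [Finset.sum_mul, Finset.mul_sum]
  refine Finset.sum_le_sum fun i _ => ?_
  rw [enorm_mul, mul_left_comm]
  gcongr
  have hk := abs_contractKernel_le hd hM hs hx ht.1 z
  have htpos : 0 < t := ht.1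
  unfold nearIndicator
  by_cases hz : z ∈ Metric.closedBall x (d * t)
  · rw [indicator_of_mem hz] at hk ⊢
    rw [mul_one, Real.enorm_eq_ofReal_abs, ENNReal.ofReal_rpow_of_pos ht.1,
      ← ENNReal.ofReal_mul (by positivity)]
    refine ENNReal.ofReal_le_ofReal ?_
    rw [Metric.mem_closedBall, dist_eq_norm] at hz
    have h2 : |z i - x i| ≤ d * t := (PiLp.norm_apply_le (z - x) i).trans hz
    rw [abs_mul, abs_mul, abs_of_pos (inv_pos.2 htpos), Real.rpow_neg htpos.le,
      Real.rpow_natCast]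
    -- The velocity is bounded by `d` on the ball, so the only singularity left is `t⁻ᴺ`.
    calc t⁻¹ * |z i - x i| * |contractKernel η x t z| ≤ t⁻¹ * (d * t) * (M * (t ^ N)⁻¹) := by
          gcongr
      _ = d * M * (t ^ N)⁻¹ := by
          have := htpos.ne'
          field_simp
  · rw [indicator_of_notMem hz] at hk ⊢
    have : contractKernel η x t z = 0 := abs_eq_zero.1 (le_antisymm hk (abs_nonneg _))
    simp [this]

end Pointwise

section Embedding

variable {N : ℕ} {Ω : Opens (EuclideanSpace ℝ (Fin N))}

/-! ### The Sobolev embedding `H¹(Ω) ⊂ L⁴(Ω)` -/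

lemma lintegral_enorm_sq_L2 (f : L2 Ω) : ∫⁻ x in (Ω : Set _), ‖f x‖ₑ ^ 2 = ‖f‖ₑ ^ 2 := by
  have h := eLpNorm_nnreal_pow_eq_lintegral (p := 2) (f := f)
    (μ := volume.restrict (Ω : Set (EuclideanSpace ℝ (Fin N)))) two_ne_zero
  rw [Lp.enorm_def]
  simpa using h.symm

/-- The Sobolev inequality `‖f‖_{L⁴} ≤ C ‖f‖_{H¹}` on bounded convex domains of dimension at
most 3. -/
lemma exists_eLpNorm_four_le (hΩ : Convex ℝ (Ω : Set (EuclideanSpace ℝ (Fin N))))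
    (hb : Bornology.IsBounded (Ω : Set (EuclideanSpace ℝ (Fin N)))) (hN : N ≤ 3) :
    ∃ C : ℝ≥0∞, C ≠ ∞ ∧ ∀ (f : L2 Ω) (g : Fin N → L2 Ω) (S : ℝ≥0∞),
      (∀ i, HasWeakPartial i f (g i)) → ‖f‖ₑ ≤ S → (∀ i, ‖g i‖ₑ ≤ S) →
      eLpNorm f 4 (volume.restrict (Ω : Set (EuclideanSpace ℝ (Fin N)))) ≤ C * S := by
  -- An empty domain carries no bump of integral one, and the claim is trivial there.
  rcases (Ω : Set (EuclideanSpace ℝ (Fin N))).eq_empty_or_nonempty with he | hne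
  · exact ⟨0, ENNReal.zero_ne_top, fun f g S _ _ _ => by
      have h0 : volume.restrict (Ω : Set (EuclideanSpace ℝ (Fin N))) = 0 := by
        rw [he, Measure.restrict_empty]
      generalize (f : EuclideanSpace ℝ (Fin N) → ℝ) = F
      rw [h0, eLpNorm_measure_zero]
      exact zero_le⟩
  obtain ⟨η, hη, hc, hs, h1⟩ := exists_normalized_bump hne
  obtain ⟨M, hM⟩ := hη.continuous.bounded_above_of_compact_support hc
  obtain ⟨R, hR0, hR⟩ := hb.exists_pos_norm_le
  have hd : ∀ y ∈ Ω, ∀ x ∈ Ω, ‖y - x‖ ≤ R + R := fun y hy x hx =>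
    (norm_sub_le _ _).trans (add_le_add (hR y hy) (hR x hx))
  obtain ⟨C, hC, hCG⟩ := lintegral_ballPotential_pow_four_le (Ω := Ω) hN (add_pos hR0 hR0).le
  set K := ENNReal.ofReal ((R + R) * M)
  set V := volume (Ω : Set (EuclideanSpace ℝ (Fin N)))
  have hV : V ≠ ∞ := hb.measure_lt_top.ne
  have hK : K ≠ ∞ := ENNReal.ofReal_ne_top
  set B := ENNReal.ofReal M
  have hB : B ≠ ∞ := ENNReal.ofReal_ne_top
  -- The factor `2 ^ 3` comes from `(a + b)⁴ ≤ 8 (a⁴ + b⁴)`. The first summand bounds the mean of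
  -- `f` by Cauchy–Schwarz; the second bounds the potential, with `N * N` from replacing `(∑ ‖gᵢ‖)²`
  -- by `N ∑ ‖gᵢ‖²`.
  set A : ℝ≥0∞ := 2 ^ 3 * ((B ^ 2 * V) ^ 2 * V + K ^ 4 * (C * (N * N) ^ 2)) with hA
  have hAtop : A ≠ ∞ := by finiteness
  refine ⟨A ^ (1 / 4 : ℝ), by finiteness, fun f g S hfg hf hg => ?_⟩
  set G : EuclideanSpace ℝ (Fin N) → ℝ≥0∞ := fun z => ∑ i, ‖g i z‖ₑ with hG
  have hGm : Measurable G :=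
    Finset.measurable_sum _ fun i _ => (Lp.stronglyMeasurable (g i)).measurable.enorm
  have hG2 : ∫⁻ z in (Ω : Set _), G z ^ 2 ≤ N * N * S ^ 2 := by
    calc ∫⁻ z in (Ω : Set _), G z ^ 2 ≤ ∫⁻ z in (Ω : Set _), N * ∑ i, ‖g i z‖ₑ ^ 2 := by
          refine lintegral_mono fun z => ?_
          have := ENNReal.rpow_sum_le_const_mul_sum_rpow Finset.univ (fun i => ‖g i z‖ₑ)
            (p := 2) (by norm_num)
          norm_num at this
          exact this
      _ = N * ∑ i, ‖g i‖ₑ ^ 2 := by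
          rw [lintegral_const_mul' _ _ (by finiteness), lintegral_finsetSum _ fun i _ =>
            ((Lp.stronglyMeasurable (g i)).measurable.enorm.pow_const 2)]
          simp_rw [lintegral_enorm_sq_L2]
      _ ≤ N * ∑ i : Fin N, S ^ 2 := by gcongr; exact hg _
      _ = _ := by simp [mul_assoc]
  set c := ∫ z in (Ω : Set _), f z * η z with hcdef
  have hc2 : ‖c‖ₑ ^ 2 ≤ B ^ 2 * V * S ^ 2 := by
    calc ‖c‖ₑ ^ 2 ≤ (∫⁻ z in (Ω : Set _), B * ‖f z‖ₑ) ^ 2 := by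
          refine pow_le_pow_left' ((enorm_integral_le_lintegral_enorm _).trans
            (lintegral_mono fun z => ?_)) 2
          rw [enorm_mul, mul_comm]
          gcongr
          rw [← ofReal_norm]
          exact ENNReal.ofReal_le_ofReal (hM z)
      _ ≤ _ := lintegral_mul_sq_le _ aemeasurable_const
          (Lp.stronglyMeasurable f).measurable.enorm.aemeasurable
      _ ≤ _ := by
          rw [lintegral_const, lintegral_enorm_sq_L2, Measure.restrict_apply_univ]
          gcongr
  have hpt := ae_enorm_sub_le_ballPotential hΩ (add_pos hR0 hR0) hd hb hη hc hs h1 hM hfg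
  have h4 : ∫⁻ x in (Ω : Set _), ‖f x‖ₑ ^ 4 ≤ A * S ^ 4 := by
    calc ∫⁻ x in (Ω : Set _), ‖f x‖ₑ ^ 4
        ≤ ∫⁻ x in (Ω : Set _), 2 ^ 3 * (‖c‖ₑ ^ 4 + K ^ 4 * ballPotential Ω (R + R) G x ^ 4) := by
          refine lintegral_mono_ae (hpt.mono fun x hx => ?_)
          have h5 : ‖f x‖ₑ ≤ ‖c‖ₑ + K * ballPotential Ω (R + R) G x := by
            calc ‖f x‖ₑ = ‖c - (c - f x)‖ₑ := by rw [sub_sub_cancel]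
              _ ≤ ‖c‖ₑ + ‖c - f x‖ₑ := enorm_sub_le
              _ ≤ _ := by gcongr
          refine (pow_le_pow_left' h5 4).trans ?_
          rw [← mul_pow]
          have := ENNReal.rpow_add_le_mul_rpow_add_rpow ‖c‖ₑ (K * ballPotential Ω (R + R) G x)
            (p := 4) (by norm_num)
          norm_num at this
          norm_num
          exact this
      _ = 2 ^ 3 * (‖c‖ₑ ^ 4 * V + K ^ 4 * ∫⁻ x in (Ω : Set _),
            ballPotential Ω (R + R) G x ^ 4) := by
          rw [lintegral_const_mul' _ _ (by finiteness), lintegral_add_left measurable_const,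
            lintegral_const, Measure.restrict_apply_univ, lintegral_const_mul' _ _ (by finiteness)]
      _ ≤ 2 ^ 3 * ((B ^ 2 * V * S ^ 2) ^ 2 * V + K ^ 4 * (C * (N * N * S ^ 2) ^ 2)) := by
          have h6 : ‖c‖ₑ ^ 4 ≤ (B ^ 2 * V * S ^ 2) ^ 2 := by
            calc ‖c‖ₑ ^ 4 = (‖c‖ₑ ^ 2) ^ 2 := by ring
              _ ≤ _ := pow_le_pow_left' hc2 2
          gcongr
          exact (hCG G hGm).trans (by gcongr)
      _ = A * S ^ 4 := by rw [hA]; ring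
  have h7 := eLpNorm_nnreal_pow_eq_lintegral (p := 4) (f := f)
    (μ := volume.restrict (Ω : Set (EuclideanSpace ℝ (Fin N)))) four_ne_zero
  simp only [ENNReal.coe_ofNat, NNReal.coe_ofNat, ENNReal.rpow_ofNat] at h7
  rw [← ENNReal.rpow_le_rpow_iff (z := 4) (by norm_num), ENNReal.mul_rpow_of_nonneg _ _ (by norm_num),
    ← ENNReal.rpow_mul]
  norm_num
  exact h7.trans_le h4

end Embedding

section Operators

variable {N : ℕ} {Ω : Opens (EuclideanSpace ℝ (Fin N))}

/-! ### The projections as continuous linear maps -/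

/-- `v ↦ v`, from `H¹(Ω)` to `L²(Ω)`. -/
def H1.fnL (Ω : Opens (EuclideanSpace ℝ (Fin N))) : H1 Ω →L[ℝ] L2 Ω :=
  (WithLp.fstL 2 ℝ (L2 Ω) (PiLp 2 (fun _ : Fin N => L2 Ω))).comp (H1sub Ω).subtypeL

/-- `v ↦ ∂ᵢ v`, from `H¹(Ω)` to `L²(Ω)`. -/
def H1.gradL (Ω : Opens (EuclideanSpace ℝ (Fin N))) (i : Fin N) : H1 Ω →L[ℝ] L2 Ω :=
  (PiLp.proj 2 (fun _ : Fin N => L2 Ω) i).comp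
    ((WithLp.sndL 2 ℝ (L2 Ω) (PiLp 2 (fun _ : Fin N => L2 Ω))).comp (H1sub Ω).subtypeL)

@[simp] lemma H1.fnL_apply (v : H1 Ω) : H1.fnL Ω v = v.fn := rfl

@[simp] lemma H1.gradL_apply (i : Fin N) (v : H1 Ω) : H1.gradL Ω i v = v.grad i := rfl

/-- The inclusion of `H²(Ω)` in `H¹(Ω)`. -/
def H2.toH1L (Ω : Opens (EuclideanSpace ℝ (Fin N))) : H2 Ω →L[ℝ] H1 Ω :=
  (WithLp.fstL 2 ℝ (H1 Ω) (PiLp 2 (fun _ : Fin N × Fin N => L2 Ω))).comp (H2sub Ω).subtypeL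

/-- `v ↦ ∂ⱼ ∂ᵢ v`, from `H²(Ω)` to `L²(Ω)`. -/
def H2.hessL (Ω : Opens (EuclideanSpace ℝ (Fin N))) (ij : Fin N × Fin N) : H2 Ω →L[ℝ] L2 Ω :=
  (PiLp.proj 2 (fun _ : Fin N × Fin N => L2 Ω) ij).comp
    ((WithLp.sndL 2 ℝ (H1 Ω) (PiLp 2 (fun _ : Fin N × Fin N => L2 Ω))).comp (H2sub Ω).subtypeL)

@[simp] lemma H2.toH1L_apply (v : H2 Ω) : H2.toH1L Ω v = v.toH1 := rfl

@[simp] lemma H2.hessL_apply (ij : Fin N × Fin N) (v : H2 Ω) : H2.hessL Ω ij v = v.hess ij := rfl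

/-- The Laplacian as a continuous linear map. -/
def H2.laplacianL (Ω : Opens (EuclideanSpace ℝ (Fin N))) : H2 Ω →L[ℝ] L2 Ω :=
  ∑ i : Fin N, H2.hessL Ω (i, i)

@[simp] lemma H2.laplacianL_apply (v : H2 Ω) : H2.laplacianL Ω v = v.laplacian := by
  simp [H2.laplacianL, H2.laplacian]

/-- The inclusion of `H²(Ω) ∩ H¹₀(Ω)` in `H²(Ω)`. -/
def H2H10.toH2L (Ω : Opens (EuclideanSpace ℝ (Fin N))) : H2H10 Ω →L[ℝ] H2 Ω :=
  (H2H10sub Ω).subtypeL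

@[simp] lemma H2H10.toH2L_apply (v : H2H10 Ω) : H2H10.toH2L Ω v = v.toH2 := rfl

lemma H1.norm_sq (v : H1 Ω) : ‖v‖ ^ 2 = ‖v.fn‖ ^ 2 + ‖v.grad‖ ^ 2 :=
  WithLp.prod_norm_sq_eq_of_L2 (α := L2 Ω) (β := PiLp 2 (fun _ : Fin N => L2 Ω)) _

lemma fluxPos_eq_fluxNeg (d c : ℝ) (m : H1 Ω) (u : H2 Ω) :
    fluxPos d c m u = fluxNeg d (-c) m u := by
  funext i x
  simp only [fluxPos, fluxNeg]
  ring

/-- The bilinear map `(x, w) ↦ P x (g w)`. -/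
def compRight {X Y Z W : Type*} [NormedAddCommGroup X] [NormedSpace ℝ X]
    [NormedAddCommGroup Y] [NormedSpace ℝ Y] [NormedAddCommGroup Z] [NormedSpace ℝ Z]
    [NormedAddCommGroup W] [NormedSpace ℝ W] (P : X →L[ℝ] Y →L[ℝ] Z) (g : W →L[ℝ] Y) :
    X →L[ℝ] W →L[ℝ] Z :=
  (P.flip.comp g).flip

/-- The pairing `(f, g) ↦ ∫_Ω f g` of `L²(Ω)`. -/
def pairingL (Ω : Opens (EuclideanSpace ℝ (Fin N))) : L2 Ω →L[ℝ] L2 Ω →L[ℝ] ℝ :=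
  (ContinuousLinearMap.mul ℝ ℝ).lpPairing (volume.restrict (Ω : Set (EuclideanSpace ℝ (Fin N)))) 2 2

instance one_le_four_fact : Fact ((1 : ℝ≥0∞) ≤ 4) := ⟨by norm_num⟩

instance holderTriple_four_four_two : ENNReal.HolderTriple 4 4 2 :=
  ⟨by rw [show (4 : ℝ≥0∞) = 2 * 2 by norm_num, ENNReal.mul_inv (by simp) (by simp), ← mul_add,
      ENNReal.inv_two_add_inv_two, mul_one]⟩

/-- The product `L⁴(Ω) × L⁴(Ω) → L²(Ω)`. -/
def mulL (Ω : Opens (EuclideanSpace ℝ (Fin N))) :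
    Lp ℝ 4 (volume.restrict (Ω : Set (EuclideanSpace ℝ (Fin N)))) →L[ℝ]
      Lp ℝ 4 (volume.restrict (Ω : Set (EuclideanSpace ℝ (Fin N)))) →L[ℝ] L2 Ω :=
  (ContinuousLinearMap.mul ℝ ℝ).holderL
    (volume.restrict (Ω : Set (EuclideanSpace ℝ (Fin N)))) 4 4 2

/-- The sum of the bilinear maps `(x, y) ↦ Rᵢ (Pᵢ x y)`. -/
def sumCompL {ι X Y Z W : Type*} [Fintype ι] [NormedAddCommGroup X] [NormedSpace ℝ X]
    [NormedAddCommGroup Y] [NormedSpace ℝ Y] [NormedAddCommGroup Z] [NormedSpace ℝ Z]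
    [NormedAddCommGroup W] [NormedSpace ℝ W] (R : ι → Z →L[ℝ] W) (P : ι → X →L[ℝ] Y →L[ℝ] Z) :
    X →L[ℝ] Y →L[ℝ] W :=
  ∑ i, (ContinuousLinearMap.compL ℝ Y Z W (R i)).comp (P i)

lemma sumCompL_apply {ι X Y Z W : Type*} [Fintype ι] [NormedAddCommGroup X] [NormedSpace ℝ X]
    [NormedAddCommGroup Y] [NormedSpace ℝ Y] [NormedAddCommGroup Z] [NormedSpace ℝ Z]
    [NormedAddCommGroup W] [NormedSpace ℝ W] (R : ι → Z →L[ℝ] W) (P : ι → X →L[ℝ] Y →L[ℝ] Z)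
    (x : X) (y : Y) : sumCompL R P x y = ∑ i, R i (P i x y) := by
  simp [sumCompL]

/-- The source space is left abstract so that the embedding applies both to `m` in `H¹` and to `∂ᵢu`
for `u` in `H²`, whose weak gradient is a row of the Hessian. -/
lemma exists_toL4 (hconv : Convex ℝ (Ω : Set (EuclideanSpace ℝ (Fin N))))
    (hb : Bornology.IsBounded (Ω : Set (EuclideanSpace ℝ (Fin N)))) (hN : N ≤ 3)
    {X : Type*} [NormedAddCommGroup X] [NormedSpace ℝ X] (f : X →L[ℝ] L2 Ω)
    (g : Fin N → X →L[ℝ] L2 Ω) (h : ∀ v i, HasWeakPartial i (f v) (g i v)) :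
    ∃ T : X →L[ℝ] Lp ℝ 4 (volume.restrict (Ω : Set (EuclideanSpace ℝ (Fin N)))),
      ∀ v, T v =ᵐ[volume.restrict (Ω : Set _)] f v := by
  obtain ⟨C, hC, hS⟩ := exists_eLpNorm_four_le hconv hb hN
  set K := ‖f‖ + ∑ i, ‖g i‖ with hK
  have hK0 : 0 ≤ K := by positivity
  have hT : ∀ v, eLpNorm (f v) 4 (volume.restrict (Ω : Set (EuclideanSpace ℝ (Fin N))))
      ≤ C * ENNReal.ofReal (K * ‖v‖) := by
    intro v
    refine hS (f v) (fun i => g i v) _ (h v) ?_ fun i => ?_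
    · rw [← ofReal_norm]
      refine ENNReal.ofReal_le_ofReal ((f.le_opNorm v).trans ?_)
      gcongr
      exact le_add_of_nonneg_right (by positivity)
    · rw [← ofReal_norm]
      refine ENNReal.ofReal_le_ofReal (((g i).le_opNorm v).trans ?_)
      gcongr
      exact (Finset.single_le_sum (f := fun i => ‖g i‖) (fun _ _ => norm_nonneg _)
        (Finset.mem_univ i)).trans (le_add_of_nonneg_left (norm_nonneg _))
  have hm : ∀ v, MemLp (f v) 4 (volume.restrict (Ω : Set (EuclideanSpace ℝ (Fin N)))) := fun v =>
    ⟨Lp.aestronglyMeasurable _, (hT v).trans_lt (by finiteness)⟩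
  let T : X →ₗ[ℝ] Lp ℝ 4 (volume.restrict (Ω : Set (EuclideanSpace ℝ (Fin N)))) :=
    { toFun := fun v => (hm v).toLp
      map_add' := fun v w => by
        rw [← MemLp.toLp_add]
        refine MemLp.toLp_congr _ _ ?_
        rw [map_add]
        exact Lp.coeFn_add _ _
      map_smul' := fun c v => by
        rw [RingHom.id_apply, ← MemLp.toLp_const_smul]
        refine MemLp.toLp_congr _ _ ?_
        rw [map_smul]
        exact Lp.coeFn_smul _ _ }
  refine ⟨T.mkContinuous (C.toReal * K) fun v => ?_, fun v => (hm v).coeFn_toLp⟩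
  change ‖(hm v).toLp‖ ≤ _
  rw [Lp.norm_toLp]
  refine (ENNReal.toReal_mono (by finiteness) (hT v)).trans (le_of_eq ?_)
  rw [ENNReal.toReal_mul, ENNReal.toReal_ofReal (by positivity), mul_assoc]

lemma exists_mulGrad (hconv : Convex ℝ (Ω : Set (EuclideanSpace ℝ (Fin N))))
    (hb : Bornology.IsBounded (Ω : Set (EuclideanSpace ℝ (Fin N)))) (hN : N ≤ 3)
    (i : Fin N) :
    ∃ P : H1 Ω →L[ℝ] H2 Ω →L[ℝ] L2 Ω, ∀ m u,
      P m u =ᵐ[volume.restrict (Ω : Set _)] fun x => m.fn x * u.toH1.grad i x := by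
  obtain ⟨S, hS⟩ := exists_toL4 hconv hb hN (H1.fnL Ω) (H1.gradL Ω) fun v j =>
    (Subtype.prop (p := fun w => w ∈ H1sub Ω) v) j
  obtain ⟨T, hT⟩ := exists_toL4 hconv hb hN ((H1.gradL Ω i).comp (H2.toH1L Ω))
    (fun j => H2.hessL Ω (i, j)) fun v j => (Subtype.prop (p := fun w => w ∈ H2sub Ω) v) i j
  refine ⟨compRight ((mulL Ω).comp S) T, fun m u => ?_⟩
  refine (ContinuousLinearMap.coeFn_holder (ContinuousLinearMap.mul ℝ ℝ) (S m) (T u)).trans ?_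
  filter_upwards [hS m, hT u] with x h1 h2
  rw [h1, h2]
  rfl

section Bounded

variable [NeZero N] [hΩ : Fact (Bornology.IsBounded (Ω : Set (EuclideanSpace ℝ (Fin N))))]

/-- Poincaré's inequality: the norm of `H¹₀` sees the gradient only, so continuity of the inclusion
in `H¹` is not automatic. -/
lemma H10.exists_norm_toH1_le (Ω : Opens (EuclideanSpace ℝ (Fin N)))
    [hΩ : Fact (Bornology.IsBounded (Ω : Set (EuclideanSpace ℝ (Fin N))))] :
    ∃ C : ℝ, ∀ v : H10 Ω, ‖v.toH1‖ ≤ C * ‖v‖ := by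
  obtain ⟨R, hR⟩ := hΩ.out.exists_norm_le
  refine ⟨Real.sqrt (4 * R ^ 2 + 1), fun v => ?_⟩
  have h := poincare hR v.2
  have h0 : ‖v.toH1.grad 0‖ ^ 2 ≤ ‖v.toH1.grad‖ ^ 2 :=
    pow_le_pow_left₀ (norm_nonneg _) (PiLp.norm_apply_le v.toH1.grad 0) 2
  have h1 : ‖v.toH1.fn‖ ^ 2 ≤ 4 * R ^ 2 * ‖v.toH1.grad‖ ^ 2 :=
    h.trans (mul_le_mul_of_nonneg_left h0 (by positivity))
  refine le_of_sq_le_sq ?_ (by positivity)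
  rw [mul_pow, Real.sq_sqrt (by positivity), H1.norm_sq, H10.norm_def]
  linarith

/-- The inclusion of `H¹₀(Ω)` in `H¹(Ω)`. -/
def H10.toH1L (Ω : Opens (EuclideanSpace ℝ (Fin N)))
    [Fact (Bornology.IsBounded (Ω : Set (EuclideanSpace ℝ (Fin N))))] : H10 Ω →L[ℝ] H1 Ω :=
  LinearMap.mkContinuousOfExistsBound
    { toFun := fun v => v.toH1
      map_add' := fun _ _ => rfl
      map_smul' := fun _ _ => rfl } (H10.exists_norm_toH1_le Ω)

@[simp] lemma H10.toH1L_apply (v : H10 Ω) : H10.toH1L Ω v = v.toH1 := rfl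

/-! ### Divergences of square integrable fields -/

/-- The functional `φ ↦ ∫_Ω w ∂ᵢφ` on `H¹₀(Ω)`, depending on `w ∈ L²(Ω)`. -/
def negPartialL (Ω : Opens (EuclideanSpace ℝ (Fin N)))
    [Fact (Bornology.IsBounded (Ω : Set (EuclideanSpace ℝ (Fin N))))] (i : Fin N) :
    L2 Ω →L[ℝ] Hneg1 Ω :=
  compRight (pairingL Ω) ((H1.gradL Ω i).comp (H10.toH1L Ω))

lemma negPartialL_apply (i : Fin N) (w : L2 Ω) (φ : H10 Ω) :
    negPartialL Ω i w φ = ∫ x in (Ω : Set _), w x * φ.toH1.grad i x :=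
  ContinuousLinearMap.lpPairing_eq_integral _ w (φ.toH1.grad i)

lemma isNegDiv_sum {w : Fin N → EuclideanSpace ℝ (Fin N) → ℝ} {W : Fin N → L2 Ω}
    (h : ∀ i, W i =ᵐ[volume.restrict (Ω : Set _)] w i) :
    IsNegDiv w (∑ i, negPartialL Ω i (W i)) := by
  intro φ
  have hi : ∀ i, Integrable (fun x => W i x * φ.toH1.grad i x) (volume.restrict (Ω : Set _)) :=
    fun i => (Lp.memLp (W i)).integrable_mul (Lp.memLp (φ.toH1.grad i))
  have he : (fun x => ∑ i, W i x * φ.toH1.grad i x)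
      =ᵐ[volume.restrict (Ω : Set _)] fun x => ∑ i, w i x * φ.toH1.grad i x := by
    filter_upwards [ae_all_iff.2 h] with x hx
    exact Finset.sum_congr rfl fun i _ => by rw [hx i]
  refine ⟨(integrable_finsetSum _ fun i _ => hi i).congr he, ?_⟩
  rw [← integral_congr_ae he, integral_finsetSum _ fun i _ => hi i]
  simp [negPartialL_apply]

/-- `IsNegDiv` prescribes the value on every `φ`, so the functional picked by choice is the only
one. -/
lemma IsNegDiv.negDiv_eq {w : Fin N → EuclideanSpace ℝ (Fin N) → ℝ} {ℓ : Hneg1 Ω}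
    (h : IsNegDiv w ℓ) : negDiv Ω w = ℓ := by
  have hex : ∃ ℓ : Hneg1 Ω, IsNegDiv w ℓ := ⟨ℓ, h⟩
  rw [negDiv, dif_pos hex]
  ext φ
  rw [(hex.choose_spec φ).2, (h φ).2]

/-- The diffusion operator `m ↦ -∇ · ∇m` on `H¹(Ω)`. -/
def diffusionL (Ω : Opens (EuclideanSpace ℝ (Fin N)))
    [Fact (Bornology.IsBounded (Ω : Set (EuclideanSpace ℝ (Fin N))))] : H1 Ω →L[ℝ] Hneg1 Ω :=
  ∑ i, (negPartialL Ω i).comp (H1.gradL Ω i)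

/-! ### The drift operator -/

/-- The drift operator `(m, u) ↦ -∇ · (m ∇u)` is a bounded bilinear map into `H⁻¹(Ω)`. -/
lemma exists_driftL (hconv : Convex ℝ (Ω : Set (EuclideanSpace ℝ (Fin N)))) (hN : N ≤ 3) :
    ∃ B : H1 Ω →L[ℝ] H2 Ω →L[ℝ] Hneg1 Ω, ∀ (d c : ℝ) (m : H1 Ω) (u : H2 Ω),
      IsNegDiv (fluxNeg d c m u) (d • diffusionL Ω m - c • B m u) := by
  choose P hP using exists_mulGrad hconv hΩ.out hN
  -- The operator does not depend on `d` and `c`, so one `B` serves both carrier species.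
  refine ⟨sumCompL (negPartialL Ω) P,
    fun d c m u => ?_⟩
  have h := isNegDiv_sum (Ω := Ω) (w := fluxNeg d c m u)
    (W := fun i => d • m.grad i - c • P i m u) fun i => by
      filter_upwards [Lp.coeFn_sub (d • m.grad i) (c • P i m u), Lp.coeFn_smul d (m.grad i),
        Lp.coeFn_smul c (P i m u), hP i m u] with x h1 h2 h3 h4
      rw [h1, Pi.sub_apply, h2, h3, Pi.smul_apply, Pi.smul_apply, h4, fluxNeg, smul_eq_mul,
        smul_eq_mul, mul_assoc]
  convert h using 1
  simp [diffusionL, sumCompL_apply, Finset.smul_sum, map_sub]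

end Bounded

end Operators

variable {N : ℕ} {Ω : Opens (EuclideanSpace ℝ (Fin N))}

/-! ### Quadratic maps with a parameter -/

section Quadratic

variable {X Y : Type*} [NormedAddCommGroup X] [NormedSpace ℝ X] [NormedAddCommGroup Y]
  [NormedSpace ℝ Y]

lemma hasFDerivAt_quadratic {F : X → Y} {c : Y} (A : X →L[ℝ] Y) (Q : X →L[ℝ] X →L[ℝ] Y)
    (hF : ∀ v, F v = c + A v + Q v v) (v : X) : HasFDerivAt F (A + Q v + Q.flip v) v := by
  have e : F = fun v => c + A v + Q v v := funext hF
  rw [e]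
  have h := (A.hasFDerivAt (x := v)).const_add c |>.add
    (Q.hasFDerivAt_of_bilinear (hasFDerivAt_id v) (hasFDerivAt_id v))
  refine h.congr_fderiv ?_
  ext w
  simp
  abel

/-- The derivative is affine in `(v, s)`, so a difference of derivatives is linear in `v₁ - v₂` and
`s₁ - s₂`, and no restriction to bounded sets is needed. -/
lemma exists_lipschitz_fderiv_quadratic {F : X → ℝ → Y} (c : ℝ → Y) (A L : X →L[ℝ] Y)
    (Q : X →L[ℝ] X →L[ℝ] Y) (hF : ∀ v s, F v s = c s + (A + s • L) v + Q v v) :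
    (∀ v s, DifferentiableAt ℝ (fun w => F w s) v) ∧
    ∃ C : ℝ, ∀ v₁ v₂ s₁ s₂, ‖fderiv ℝ (fun w => F w s₁) v₁ - fderiv ℝ (fun w => F w s₂) v₂‖
      ≤ C * Real.sqrt (‖v₁ - v₂‖ ^ 2 + |s₁ - s₂| ^ 2) := by
  have hd : ∀ v s, HasFDerivAt (fun w => F w s) (A + s • L + Q v + Q.flip v) v := fun v s =>
    hasFDerivAt_quadratic (A + s • L) Q (fun w => hF w s) v
  refine ⟨fun v s => (hd v s).differentiableAt, ‖Q + Q.flip‖ + ‖L‖, fun v₁ v₂ s₁ s₂ => ?_⟩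
  rw [(hd v₁ s₁).fderiv, (hd v₂ s₂).fderiv]
  have e : A + s₁ • L + Q v₁ + Q.flip v₁ - (A + s₂ • L + Q v₂ + Q.flip v₂)
      = (Q + Q.flip) (v₁ - v₂) + (s₁ - s₂) • L := by
    rw [add_apply, map_sub, map_sub]
    module
  have h1 : ‖v₁ - v₂‖ ≤ Real.sqrt (‖v₁ - v₂‖ ^ 2 + |s₁ - s₂| ^ 2) :=
    Real.le_sqrt_of_sq_le (le_add_of_nonneg_right (sq_nonneg _))
  have h2 : |s₁ - s₂| ≤ Real.sqrt (‖v₁ - v₂‖ ^ 2 + |s₁ - s₂| ^ 2) :=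
    Real.le_sqrt_of_sq_le (le_add_of_nonneg_left (sq_nonneg _))
  rw [e, add_mul]
  refine (norm_add_le _ _).trans (add_le_add ?_ ?_)
  · exact ((Q + Q.flip).le_opNorm _).trans (mul_le_mul_of_nonneg_left h1 (norm_nonneg _))
  · rw [norm_smul, Real.norm_eq_abs, mul_comm]
    exact mul_le_mul_of_nonneg_left h2 (norm_nonneg _)

/-- Pure algebra over abstract spaces: each component is affine or bilinear in shifted projections
of `h`. Expanding the shifts `a`, `b`, `b'` puts the mixed terms `B b` and `B.flip a` into the
linear part, and only the products of projections remain in `Q`. -/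
lemma exists_quadratic_form_withLp {V₁ V₂ X₁ X₂ Y Z : Type*}
    [NormedAddCommGroup V₁] [NormedSpace ℝ V₁] [NormedAddCommGroup V₂] [NormedSpace ℝ V₂]
    [NormedAddCommGroup X₁] [NormedSpace ℝ X₁] [NormedAddCommGroup X₂] [NormedSpace ℝ X₂]
    [NormedAddCommGroup Y] [NormedSpace ℝ Y] [NormedAddCommGroup Z] [NormedSpace ℝ Z]
    (i₁ : V₁ →L[ℝ] X₁) (i₂ : V₂ →L[ℝ] X₂) (Λ : X₁ →L[ℝ] Z) (f : X₂ →L[ℝ] Z) (T : X₂ →L[ℝ] Y)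
    (B : X₂ →L[ℝ] X₁ →L[ℝ] Y) (a : X₁) (b b' : X₂) (D : Z) (d c d' c' : ℝ) :
    ∃ (C : ℝ → WithLp 2 (Z × WithLp 2 (Y × Y)))
      (A L : WithLp 2 (V₁ × WithLp 2 (V₂ × V₂)) →L[ℝ] WithLp 2 (Z × WithLp 2 (Y × Y)))
      (Q : WithLp 2 (V₁ × WithLp 2 (V₂ × V₂)) →L[ℝ] WithLp 2 (V₁ × WithLp 2 (V₂ × V₂)) →L[ℝ]
        WithLp 2 (Z × WithLp 2 (Y × Y))), ∀ h s,
      WithLp.toLp 2 (-Λ (i₁ h.fst + a) + s • (f (i₂ h.snd.fst + b) - f (i₂ h.snd.snd + b')) - D,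
        WithLp.toLp 2 (d • T (i₂ h.snd.fst + b) - c • B (i₂ h.snd.fst + b) (i₁ h.fst + a),
          d' • T (i₂ h.snd.snd + b') - c' • B (i₂ h.snd.snd + b') (i₁ h.fst + a)))
        = C s + (A + s • L) h + Q h h := by
  let W := WithLp 2 (Z × WithLp 2 (Y × Y))
  let V := WithLp 2 (V₁ × WithLp 2 (V₂ × V₂))
  let toW : (Z × Y × Y) →L[ℝ] W :=
    ((WithLp.prodContinuousLinearEquiv 2 ℝ Z (WithLp 2 (Y × Y))).symm : _ →L[ℝ] W).comp
      ((ContinuousLinearMap.id ℝ Z).prodMap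
        ((WithLp.prodContinuousLinearEquiv 2 ℝ Y Y).symm : _ →L[ℝ] WithLp 2 (Y × Y)))
  let j₁ : Z →L[ℝ] W := toW.comp (.inl ℝ Z (Y × Y))
  let j₂ : Y →L[ℝ] W := toW.comp ((ContinuousLinearMap.inr ℝ Z (Y × Y)).comp (.inl ℝ Y Y))
  let j₃ : Y →L[ℝ] W := toW.comp ((ContinuousLinearMap.inr ℝ Z (Y × Y)).comp (.inr ℝ Y Y))
  let p₁ : V →L[ℝ] X₁ := i₁.comp (WithLp.fstL 2 ℝ V₁ (WithLp 2 (V₂ × V₂)))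
  let p₂ : V →L[ℝ] X₂ :=
    i₂.comp ((WithLp.fstL 2 ℝ V₂ V₂).comp (WithLp.sndL 2 ℝ V₁ (WithLp 2 (V₂ × V₂))))
  let p₃ : V →L[ℝ] X₂ :=
    i₂.comp ((WithLp.sndL 2 ℝ V₂ V₂).comp (WithLp.sndL 2 ℝ V₁ (WithLp 2 (V₂ × V₂))))
  have hj : ∀ z y y', (WithLp.toLp 2 (z, WithLp.toLp 2 (y, y')) : W) = j₁ z + j₂ y + j₃ y' := by
    intro z y y'
    have e : (z, y, y') = ((z, 0, 0) : Z × Y × Y) + (0, y, 0) + (0, 0, y') := by simp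
    calc _ = toW (z, y, y') := rfl
      _ = toW (z, 0, 0) + toW (0, y, 0) + toW (0, 0, y') := by rw [e, map_add, map_add]
      _ = _ := rfl
  have h₁ : ∀ h : V, i₁ h.fst = p₁ h := fun _ => rfl
  have h₂ : ∀ h : V, i₂ h.snd.fst = p₂ h := fun _ => rfl
  have h₃ : ∀ h : V, i₂ h.snd.snd = p₃ h := fun _ => rfl
  refine ⟨fun s => j₁ (-Λ a + s • (f b - f b') - D) + j₂ (d • T b - c • B b a)
      + j₃ (d' • T b' - c' • B b' a),
    -(j₁.comp (Λ.comp p₁)) + j₂.comp (d • T.comp p₂ - c • ((B.flip a).comp p₂ + (B b).comp p₁))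
      + j₃.comp (d' • T.comp p₃ - c' • ((B.flip a).comp p₃ + (B b').comp p₁)),
    j₁.comp (f.comp p₂ - f.comp p₃),
    -(c • (ContinuousLinearMap.compL ℝ V Y W j₂).comp ((B.comp p₂).flip.comp p₁).flip)
      - c' • (ContinuousLinearMap.compL ℝ V Y W j₃).comp ((B.comp p₃).flip.comp p₁).flip,
    fun h s => ?_⟩
  rw [hj, h₁, h₂, h₃]
  -- Only linearity of the injections and projections matters from here, so their definitions are
  -- forgotten.
  generalize j₁ = j₁, j₂ = j₂, j₃ = j₃, p₁ = p₁, p₂ = p₂, p₃ = p₃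
  simp only [map_add, map_sub, map_neg, map_smul, add_apply,
    sub_apply, neg_apply, smul_apply,
    ContinuousLinearMap.comp_apply, ContinuousLinearMap.compL_apply, ContinuousLinearMap.flip_apply]
  module

end Quadratic

/-! ### The drift-diffusion map is quadratic -/

variable [NeZero N] [hΩ : Fact (Bornology.IsBounded (Ω : Set (EuclideanSpace ℝ (Fin N))))]

lemma exists_driftDiffusionMap_eq {dn cn dp cp : ℝ}
    {D : Lp ℝ ∞ (volume.restrict (Ω : Set (EuclideanSpace ℝ (Fin N))))}
    {au : H2 Ω} {an ap : H1 Ω} {B : H1 Ω →L[ℝ] H2 Ω →L[ℝ] Hneg1 Ω}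
    (hB : ∀ (d c : ℝ) (m : H1 Ω) (u : H2 Ω),
      IsNegDiv (fluxNeg d c m u) (d • diffusionL Ω m - c • B m u)) :
    ∃ (c : ℝ → Gspace Ω) (A L : Hspace Ω →L[ℝ] Gspace Ω)
      (Q : Hspace Ω →L[ℝ] Hspace Ω →L[ℝ] Gspace Ω), ∀ h s,
      driftDiffusionMap dn cn dp cp D au an ap h s = c s + (A + s • L) h + Q h h := by
  -- The coefficient `-cp` reflects the opposite drift of the positive carriers, as in
  -- `fluxPos_eq_fluxNeg`.
  obtain ⟨C, A, L, Q, h⟩ := exists_quadratic_form_withLp (H2H10.toH2L Ω) (H10.toH1L Ω)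
    (H2.laplacianL Ω) (H1.fnL Ω) (diffusionL Ω) B au an ap (inftyToL2 D) dn cn dp (-cp)
  refine ⟨C, A, L, Q, fun v s => ?_⟩
  rw [← h v s, driftDiffusionMap, fluxPos_eq_fluxNeg, (hB _ _ _ _).negDiv_eq,
    (hB _ _ _ _).negDiv_eq, ← H2.laplacianL_apply]
  rfl

end DriftDiffusion

end

open DriftDiffusion
theorem mainTheorem5 {N : ℕ} [NeZero N] (hN : N = 2 ∨ N = 3)
    (Ω : Opens (EuclideanSpace ℝ (Fin N)))
    [hΩ : Fact (Bornology.IsBounded (Ω : Set (EuclideanSpace ℝ (Fin N))))]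
    (hconv : Convex ℝ (Ω : Set (EuclideanSpace ℝ (Fin N))))
    (dn cn dp cp : ℝ) (hdn : 0 < dn) (hcn : 0 < cn) (hdp : 0 < dp) (hcp : 0 < cp)
    (D : Lp ℝ ∞ (volume.restrict (Ω : Set (EuclideanSpace ℝ (Fin N)))))
    (au : H2 Ω) (an ap : H1 Ω) :
    -- the map is well defined: its last two components are the functionals `-∇ · (flux)`
    (∀ h : Hspace Ω, ∀ lam ∈ Icc (0 : ℝ) 1,
      IsNegDiv (fluxNeg dn cn (negDensity an h) (potential au h))
        (driftDiffusionMap dn cn dp cp D au an ap h lam).snd.fst ∧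
      IsNegDiv (fluxPos dp cp (posDensity ap h) (potential au h))
        (driftDiffusionMap dn cn dp cp D au an ap h lam).snd.snd) ∧
    -- the partial Fréchet derivative with respect to `h` exists everywhere
    (∀ h : Hspace Ω, ∀ lam ∈ Icc (0 : ℝ) 1,
      DifferentiableAt ℝ (fun k => driftDiffusionMap dn cn dp cp D au an ap k lam) h) ∧
    -- and it is globally Lipschitz continuous in `(h, lam)`, in the operator norm
    ∃ C : ℝ, ∀ h₁ h₂ : Hspace Ω, ∀ lam₁ ∈ Icc (0 : ℝ) 1, ∀ lam₂ ∈ Icc (0 : ℝ) 1,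
      ‖fderiv ℝ (fun k => driftDiffusionMap dn cn dp cp D au an ap k lam₁) h₁ -
          fderiv ℝ (fun k => driftDiffusionMap dn cn dp cp D au an ap k lam₂) h₂‖
        ≤ C * Real.sqrt (‖h₁ - h₂‖ ^ 2 + |lam₁ - lam₂| ^ 2) := by
  have hN3 : N ≤ 3 := by omega
  obtain ⟨B, hB⟩ := exists_driftL hconv hN3
  obtain ⟨c, A, L, Q, hF⟩ := exists_driftDiffusionMap_eq (dn := dn) (cn := cn) (dp := dp)
    (cp := cp) (D := D) (au := au) (an := an) (ap := ap) hB
  obtain ⟨hdiff, C, hC⟩ := exists_lipschitz_fderiv_quadratic c A L Q hF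
  refine ⟨fun h lam _ => ⟨?_, ?_⟩, fun h lam _ => hdiff h lam,
    C, fun h₁ h₂ lam₁ _ lam₂ _ => hC h₁ h₂ lam₁ lam₂⟩
  · change IsNegDiv _ (negDiv Ω _)
    rw [(hB _ _ _ _).negDiv_eq]
    exact hB _ _ _ _
  · change IsNegDiv _ (negDiv Ω _)
    rw [fluxPos_eq_fluxNeg, (hB _ _ _ _).negDiv_eq]
    exact hB _ _ _ _
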